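/- Let $M$ be a smooth surface with a Kähler structure $(g_{ij}, J_i{}^j)$, Levi-Civita connection $D$, volume form $\Omega_{ij} = J_i{}^p g_{pj}$ and scalar curvature $R_g = g^{ij}R_{ij}$ (twice the Gauss curvature). Indices are raised with the bivector $\Omega^{ij}$ determined by $\Omega^{ip}\Omega_{pj} = -\delta_j{}^i$, by the rule $\alpha^i = \Omega^{ip}\alpha_p$. A symplectic connection on $(M, \Omega)$ is a torsion-free affine connection $\nabla$ with $\nabla\Omega = 0$. Its curvature is $R_{ijp}{}^kY^p = 2\nabla_{[i}\nabla_{j]}Y^k$, its Ricci curvature is $R_{ij} = R_{pij}{}^p$, its curvature one-form is $\rho(\nabla)_i = 2\nabla^pR_{ip}$, and its moment map is $$\mathcal K(\nabla) = \nabla^i\nabla^jR_{ij} - \tfrac12 R^{ij}R_{ij} + \tfrac14 R^{ijkl}R_{ijkl}, \qquad R_{ijkl} = R_{ijk}{}^p\Omega_{pl};$$ $\nabla$ is moment flat if $\mathcal K(\nabla) = 0$. A torsion-free connection on a surface is projectively flat if, with $P_{ij} = -R_{(ij)} - \tfrac13 R_{[ij]}$, its projective Weyl tensor $R_{ijk}{}^l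 + 2\delta_{[i}{}^lP_{j]k} - 2\delta_k{}^lP_{[ij]}$ and its projective Cotton tensor $2\nabla_{[i}P_{j]k}$ vanish. Let $X_i$ be a harmonic one-form on $M$ (that is, smooth, closed and $g$-coclosed), and let $$\Pi_{ijk} = 3X_{(i}g_{jk)} = X_ig_{jk} + X_jg_{ik} + X_kg_{ij}, \qquad \Pi_{ij}{}^k = \Omega^{kp}\Pi_{ijp}.$$ Then $\nabla = D + \Pi_{ij}{}^k$ is a symplectic connection on $(M, \Omega)$, and $$\rho(\nabla)_i = \rho(D)_i - 6R_gX_i.$$ In particular, if $R_g$ is constant, then $\rho(\nabla)_i = -6R_gX_i$ and $\mathcal K(\nabla) = 0$, so $\nabla$ is moment flat; and in this case, if $\nabla$ is projectively flat, then $X = 0$ or $R_g = 0$. -/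

import Mathlib

open Bundle Manifold ContDiff

noncomputable section

/-- The tangent space at a point of a smooth surface. -/
local notation "𝕋" => TangentSpace (modelWithCornersSelf ℝ (EuclideanSpace ℝ (Fin 2)))

/-- Affine connections on a surface `M`; here `D Y x u` is the value at `x` of the covariant
derivative of the vector field `Y` in the direction of the tangent vector `u`. -/
abbrev AffineConnection (M : Type*) [TopologicalSpace M]
    [ChartedSpace (EuclideanSpace ℝ (Fin 2)) M] [IsManifold (𝓡 2) ∞ M] :=
  CovariantDerivative (𝓡 2) (EuclideanSpace ℝ (Fin 2)) (TangentSpace (𝓡 2) : M → Type _)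

namespace Surface

section Frames

variable {M : Type*} [TopologicalSpace M] [ChartedSpace (EuclideanSpace ℝ (Fin 2)) M]

/-- The coordinate basis of `T_x M`. All contractions below are independent of the basis. -/
def basis (x : M) : Module.Basis (Fin 2) ℝ (𝕋 x) :=
  (EuclideanSpace.basisFun (Fin 2) ℝ).toBasis

/-- The local vector field through the tangent vector `v` that is constant in the preferred
trivialization of the tangent bundle around the base point of `v`. -/
def field [IsManifold (𝓡 2) ∞ M] {x : M} (v : 𝕋 x) : Π y : M, 𝕋 y :=
  FiberBundle.extend (EuclideanSpace ℝ (Fin 2)) v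

/-- Smooth vector fields on `M`. -/
def IsSmoothField [IsManifold (𝓡 2) ∞ M] (Y : Π x : M, 𝕋 x) : Prop :=
  ContMDiff (𝓡 2) ((𝓡 2).prod 𝓘(ℝ, EuclideanSpace ℝ (Fin 2))) ∞
    (fun x ↦ TotalSpace.mk' (EuclideanSpace ℝ (Fin 2)) (E := fun x : M ↦ 𝕋 x) x (Y x))

/-- The matrix `b_{ij}` of a covariant two-tensor at `x`. -/
def mat {x : M} (b : 𝕋 x → 𝕋 x → ℝ) : Matrix (Fin 2) (Fin 2) ℝ :=
  Matrix.of fun i j ↦ b (basis x i) (basis x j)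

end Frames

section Connections

variable {M : Type*} [TopologicalSpace M] [ChartedSpace (EuclideanSpace ℝ (Fin 2)) M]
  [IsManifold (𝓡 2) ∞ M]

/-- The covariant derivative `(∇_u α)(v)` of a one-form. -/
def covOneForm (D : AffineConnection M) (α : Π x : M, 𝕋 x → ℝ) (x : M) (u v : 𝕋 x) : ℝ :=
  mvfderiv (𝓡 2) (fun y ↦ α y (field v y)) x u - α x (D (field v) x u)

/-- The covariant derivative `(∇_u B)(v, w)` of a covariant two-tensor. -/
def covTwoTensor (D : AffineConnection M) (B : Π x : M, 𝕋 x → 𝕋 x → ℝ) (x : M)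
    (u v w : 𝕋 x) : ℝ :=
  mvfderiv (𝓡 2) (fun y ↦ B y (field v y) (field w y)) x u
    - B x (D (field v) x u) w - B x v (D (field w) x u)

/-- The curvature `R(u, v)w = ∇_u ∇_v w - ∇_v ∇_u w - ∇_{[u, v]} w`,
in indices `R_{ijk}^l u^i v^j w^k`. -/
def curvature (D : AffineConnection M) (x : M) (u v w : 𝕋 x) : 𝕋 x :=
  D (fun y ↦ D (field w) y (field v y)) x u - D (fun y ↦ D (field w) y (field u y)) x v
    - D (field w) x (VectorField.mlieBracket (𝓡 2) (field u) (field v) x)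

/-- The Ricci curvature `R_{ij} = R_{pij}^p`. -/
def ricci (D : AffineConnection M) (x : M) (v w : 𝕋 x) : ℝ :=
  ∑ p, (basis x).repr (curvature D x (basis x p) v w) p

/-- The tensor `P_{ij} = -R_{(ij)} - (1/3) R_{[ij]}`, which is the projective Schouten tensor in
dimension two. -/
def projSchouten (D : AffineConnection M) (x : M) (v w : 𝕋 x) : ℝ :=
  -((ricci D x v w + ricci D x w v) / 2) - (1 / 3) * ((ricci D x v w - ricci D x w v) / 2)

/-- The projective Weyl tensor
`B_{ijk}^l = R_{ijk}^l + 2 δ_{[i}^l P_{j]k} - 2 δ_k^l P_{[ij]}`. -/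
def projWeyl (D : AffineConnection M) (x : M) (u v w : 𝕋 x) : 𝕋 x :=
  curvature D x u v w + (projSchouten D x v w • u - projSchouten D x u w • v)
    - (projSchouten D x u v - projSchouten D x v u) • w

/-- The projective Cotton tensor `C_{ijk} = 2 ∇_{[i} P_{j]k}`. -/
def projCotton (D : AffineConnection M) (x : M) (u v w : 𝕋 x) : ℝ :=
  covTwoTensor D (projSchouten D) x u v w - covTwoTensor D (projSchouten D) x v u w

/-- A torsion-free affine connection on a surface is projectively flat if its projective Weyl
tensor and its projective Cotton tensor vanish. -/
def IsProjectivelyFlat (D : AffineConnection M) : Prop :=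
  (∀ (x : M) (u v w : 𝕋 x), projWeyl D x u v w = 0) ∧
    ∀ (x : M) (u v w : 𝕋 x), projCotton D x u v w = 0

end Connections

section Symplectic

variable {M : Type*} [TopologicalSpace M] [ChartedSpace (EuclideanSpace ℝ (Fin 2)) M]
  [IsManifold (𝓡 2) ∞ M]

/-- A symplectic connection: a smooth torsion-free affine connection for which `Ω` is parallel. -/
structure IsSymplecticConnection (Ω : Π x : M, 𝕋 x →L[ℝ] 𝕋 x →L[ℝ] ℝ)
    (D : AffineConnection M) : Prop where
  smooth : CovariantDerivative.ContMDiffCovariantDerivative D ∞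
  torsion_eq_zero : D.torsion = 0
  parallel : ∀ (x : M) (u v w : 𝕋 x), covTwoTensor D (fun y a b ↦ Ω y a b) x u v w = 0

/-- The components `Ω^{ij}` of the dual bivector, normalized by `Ω^{ip} Ω_{pj} = -δ_j^i`. -/
def dualBivector (Ω : Π x : M, 𝕋 x →L[ℝ] 𝕋 x →L[ℝ] ℝ) (x : M) : Matrix (Fin 2) (Fin 2) ℝ :=
  -(mat fun u v ↦ Ω x u v)⁻¹

/-- The vector `Z^i = Ω^{ip} α_p`. -/
def raise (Ω : Π x : M, 𝕋 x →L[ℝ] 𝕋 x →L[ℝ] ℝ) (x : M) (α : 𝕋 x → ℝ) : 𝕋 x :=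
  ∑ i, ∑ p, (dualBivector Ω x i p * α (basis x p)) • basis x i

/-- The curvature one-form `ρ_i = 2 ∇^p R_{ip} = 2 Ω^{pq} ∇_q R_{ip}`. -/
def curvatureOneForm (Ω : Π x : M, 𝕋 x →L[ℝ] 𝕋 x →L[ℝ] ℝ) (D : AffineConnection M)
    (x : M) (v : 𝕋 x) : ℝ :=
  2 * ∑ p, ∑ q, dualBivector Ω x p q * covTwoTensor D (ricci D) x (basis x q) v (basis x p)

/-- The components `R_{ij}` of the Ricci curvature. -/
def ricciLow (D : AffineConnection M) (x : M) (i j : Fin 2) : ℝ :=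
  ricci D x (basis x i) (basis x j)

/-- The components `R_{ijkl} = R_{ijk}^p Ω_{pl}` of the curvature. -/
def curvatureLow (Ω : Π x : M, 𝕋 x →L[ℝ] 𝕋 x →L[ℝ] ℝ) (D : AffineConnection M)
    (x : M) (i j k l : Fin 2) : ℝ :=
  Ω x (curvature D x (basis x i) (basis x j) (basis x k)) (basis x l)

/-- The square `R^{ij} R_{ij}`, where `R^{ij} = Ω^{ia} Ω^{jb} R_{ab}`. -/
def ricciSq (Ω : Π x : M, 𝕋 x →L[ℝ] 𝕋 x →L[ℝ] ℝ) (D : AffineConnection M) (x : M) : ℝ :=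
  let W := dualBivector Ω x
  ∑ i, ∑ j, ∑ a, ∑ b, W i a * W j b * ricciLow D x a b * ricciLow D x i j

/-- The square `R^{ijkl} R_{ijkl}`, where
`R^{ijkl} = Ω^{ia} Ω^{jb} Ω^{kc} Ω^{ld} R_{abcd}`. -/
def curvatureSq (Ω : Π x : M, 𝕋 x →L[ℝ] 𝕋 x →L[ℝ] ℝ) (D : AffineConnection M) (x : M) : ℝ :=
  let W := dualBivector Ω x
  ∑ i, ∑ j, ∑ k, ∑ l, ∑ a, ∑ b, ∑ c, ∑ d,
    W i a * W j b * W k c * W l d * curvatureLow Ω D x a b c d * curvatureLow Ω D x i j k l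

/-- The Cahen-Gutt moment map
`K = ∇^i ∇^j R_{ij} - (1/2) R^{ij} R_{ij} + (1/4) R^{ijkl} R_{ijkl}`; the first term is
`(1/2) ∇^i ρ_i = (1/2) Ω^{ip} ∇_p ρ_i`. -/
def momentMap (Ω : Π x : M, 𝕋 x →L[ℝ] 𝕋 x →L[ℝ] ℝ) (D : AffineConnection M) (x : M) : ℝ :=
  (1 / 2) * (∑ i, ∑ p, dualBivector Ω x i p *
      covOneForm D (curvatureOneForm Ω D) x (basis x p) (basis x i))
    - (1 / 2) * ricciSq Ω D x + (1 / 4) * curvatureSq Ω D x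

/-- A connection is moment flat if its moment map vanishes identically. -/
def IsMomentFlat (Ω : Π x : M, 𝕋 x →L[ℝ] 𝕋 x →L[ℝ] ℝ) (D : AffineConnection M) : Prop :=
  ∀ x, momentMap Ω D x = 0

end Symplectic

section Kahler

variable {M : Type*} [TopologicalSpace M] [ChartedSpace (EuclideanSpace ℝ (Fin 2)) M]
  [IsManifold (𝓡 2) ∞ M] [RiemannianBundle (fun x : M ↦ TangentSpace (𝓡 2) x)]

/-- The two-form `Ω_{ij} = J_i^p g_{pj}`, that is `Ω(u, v) = g(Ju, v)`. -/
def kahlerForm (J : Π x : M, 𝕋 x →L[ℝ] 𝕋 x) (x : M) : 𝕋 x →L[ℝ] 𝕋 x →L[ℝ] ℝ :=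
  innerSL ℝ ∘L J x

/-- The endomorphism field `J` makes the Riemannian surface `(M, g)` a Kähler surface: it is a
smooth integrable almost complex structure, `g` is Hermitian, and the Kähler form is closed. -/
structure IsKahler (J : Π x : M, 𝕋 x →L[ℝ] 𝕋 x) : Prop where
  smooth : ContMDiff (𝓡 2)
    ((𝓡 2).prod 𝓘(ℝ, EuclideanSpace ℝ (Fin 2) →L[ℝ] EuclideanSpace ℝ (Fin 2))) ∞
    (fun x ↦ TotalSpace.mk' (EuclideanSpace ℝ (Fin 2) →L[ℝ] EuclideanSpace ℝ (Fin 2))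
      (E := fun x : M ↦ 𝕋 x →L[ℝ] 𝕋 x) x (J x))
  sq : ∀ (x : M) (u : 𝕋 x), J x (J x u) = -u
  hermitian : ∀ (x : M) (u v : 𝕋 x), inner ℝ (J x u) (J x v) = inner ℝ u v
  integrable : ∀ Y Z : Π x : M, 𝕋 x, IsSmoothField Y → IsSmoothField Z → ∀ x : M,
      VectorField.mlieBracket (𝓡 2) (fun y ↦ J y (Y y)) (fun y ↦ J y (Z y)) x
        - J x (VectorField.mlieBracket (𝓡 2) (fun y ↦ J y (Y y)) Z x)
        - J x (VectorField.mlieBracket (𝓡 2) Y (fun y ↦ J y (Z y)) x)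
        - VectorField.mlieBracket (𝓡 2) Y Z x = 0
  closed : ∀ U V W : Π x : M, 𝕋 x,
    IsSmoothField U → IsSmoothField V → IsSmoothField W → ∀ x : M,
      mvfderiv (𝓡 2) (fun y ↦ kahlerForm J y (V y) (W y)) x (U x)
        + mvfderiv (𝓡 2) (fun y ↦ kahlerForm J y (W y) (U y)) x (V x)
        + mvfderiv (𝓡 2) (fun y ↦ kahlerForm J y (U y) (V y)) x (W x)
        - kahlerForm J x (VectorField.mlieBracket (𝓡 2) U V x) (W x)
        - kahlerForm J x (VectorField.mlieBracket (𝓡 2) V W x) (U x)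
        - kahlerForm J x (VectorField.mlieBracket (𝓡 2) W U x) (V x) = 0

/-- The components `g^{ij}` of the inverse metric. -/
def inverseMetric (x : M) : Matrix (Fin 2) (Fin 2) ℝ :=
  (mat fun u v : 𝕋 x ↦ inner ℝ u v)⁻¹

/-- The scalar curvature `R_g = g^{ij} R_{ij}`, for `D` the Levi-Civita connection of `g`. -/
def scalarCurvature (D : AffineConnection M) (x : M) : ℝ :=
  ∑ i, ∑ j, inverseMetric x i j * ricci D x (basis x i) (basis x j)

/-- The covariant tensor `Π_{ijk} = 3 X_{(i} g_{jk)} = X_i g_{jk} + X_j g_{ik} + X_k g_{ij}`. -/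
def cubicForm (X : Π x : M, 𝕋 x →L[ℝ] ℝ) (x : M) (u v w : 𝕋 x) : ℝ :=
  X x u * inner ℝ v w + X x v * inner ℝ u w + X x w * inner ℝ u v

/-- The difference tensor `Π_{ij}^k = Ω^{kp} Π_{ijp}`, as a vector valued bilinear form. -/
def differenceTensor (Ω : Π x : M, 𝕋 x →L[ℝ] 𝕋 x →L[ℝ] ℝ) (X : Π x : M, 𝕋 x →L[ℝ] ℝ)
    (x : M) : 𝕋 x →L[ℝ] 𝕋 x →L[ℝ] 𝕋 x :=
  have : FiniteDimensional ℝ (𝕋 x) := (basis x).finiteDimensional_of_finite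
  have : T2Space (𝕋 x) := inferInstanceAs (T2Space (EuclideanSpace ℝ (Fin 2)))
  IsBilinearMap.toContinuousBilinearMap (𝕜 := ℝ)
    (f := fun u v : 𝕋 x ↦ raise Ω x (cubicForm X x u v))
    { add_left := fun u u' v ↦ by
        simp only [raise, cubicForm, map_add, inner_add_left, ← Finset.sum_add_distrib, ← add_smul]
        refine Finset.sum_congr rfl fun _ _ ↦ Finset.sum_congr rfl fun _ _ ↦
          congrArg (fun t : ℝ ↦ t • _) ?_
        ring
      smul_left := fun c u v ↦ by
        simp only [raise, cubicForm, map_smul, real_inner_smul_left, smul_eq_mul, Finset.smul_sum,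
          smul_smul]
        refine Finset.sum_congr rfl fun _ _ ↦ Finset.sum_congr rfl fun _ _ ↦
          congrArg (fun t : ℝ ↦ t • _) ?_
        ring
      add_right := fun u v v' ↦ by
        simp only [raise, cubicForm, map_add, inner_add_left, inner_add_right,
          ← Finset.sum_add_distrib, ← add_smul]
        refine Finset.sum_congr rfl fun _ _ ↦ Finset.sum_congr rfl fun _ _ ↦
          congrArg (fun t : ℝ ↦ t • _) ?_
        ring
      smul_right := fun c u v ↦ by
        simp only [raise, cubicForm, map_smul, real_inner_smul_left, real_inner_smul_right, smul_eq_mul,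
          Finset.smul_sum, smul_smul]
        refine Finset.sum_congr rfl fun _ _ ↦ Finset.sum_congr rfl fun _ _ ↦
          congrArg (fun t : ℝ ↦ t • _) ?_
        ring }

/-- The connection `∇ = D + Π_{ij}^k` on the surface with symplectic form `Ω`, where
`Π_{ijk} = 3 X_{(i} g_{jk)}`; thus `∇_u Y = D_u Y + Π(u, Y)`. -/
def deformedConnection (Ω : Π x : M, 𝕋 x →L[ℝ] 𝕋 x →L[ℝ] ℝ) (D : AffineConnection M)
    (X : Π x : M, 𝕋 x →L[ℝ] ℝ) : AffineConnection M :=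
  D.addOneForm (differenceTensor Ω X)

/-- A harmonic one-form, where `D` is the Levi-Civita connection of the metric: a smooth one-form
that is closed, `D_{[i} X_{j]} = 0`, and coclosed, `g^{ij} D_i X_j = 0`. -/
structure IsHarmonicOneForm (D : AffineConnection M) (X : Π x : M, 𝕋 x →L[ℝ] ℝ) : Prop where
  smooth : ContMDiff (𝓡 2) ((𝓡 2).prod 𝓘(ℝ, EuclideanSpace ℝ (Fin 2) →L[ℝ] ℝ)) ∞
    (fun x ↦ TotalSpace.mk' (EuclideanSpace ℝ (Fin 2) →L[ℝ] ℝ)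
      (E := fun x : M ↦ 𝕋 x →L[ℝ] ℝ) x (X x))
  closed : ∀ (x : M) (u v : 𝕋 x),
    covOneForm D (fun y w ↦ X y w) x u v = covOneForm D (fun y w ↦ X y w) x v u
  coclosed : ∀ x : M, ∑ i, ∑ j, inverseMetric x i j *
    covOneForm D (fun y w ↦ X y w) x (basis x i) (basis x j) = 0

variable [IsContMDiffRiemannianBundle (𝓡 2) ∞ (EuclideanSpace ℝ (Fin 2))
  (fun x : M ↦ TangentSpace (𝓡 2) x)]

/-- The connection `D` is the Levi-Civita connection of the metric: it is smooth, torsion-free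
and compatible with the metric. -/
structure IsLeviCivita (D : AffineConnection M) : Prop where
  smooth : CovariantDerivative.ContMDiffCovariantDerivative D ∞
  torsion_eq_zero : D.torsion = 0
  metric :
    have : IsContMDiffRiemannianBundle (𝓡 2) 1 (EuclideanSpace ℝ (Fin 2))
        (fun x : M ↦ TangentSpace (𝓡 2) x) :=
      IsContMDiffRiemannianBundle.of_le (n := ∞) (by simp)
    D.IsMetricCompatible

end Kahler

end Surface

end

/-! Everything is computed in a local orthonormal frame `E 0`, `E 1 = J (E 0)`, in which `Ω(E 0, E
1) = 1`. Write `K` for the Gauss curvature, so that `R_g = 2K`. Harmonicity says exactly that the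
matrix of `DX` is symmetric and trace-free, hence has two independent entries, `derivDiag` and
`derivOff`. The structure equations then give (`IsAdaptedFrame.ricci_deformedConnection`) `Ric(∇) =
K g - 2 DX(J·,·) + 8 X ⊗ X - 2 |X|² g`.

Taking the divergence with respect to `∇`, all terms quadratic and cubic in `X` cancel. The term in
`DX` contributes `-4 D^p D_p X`, which is `-4KX` by the Weitzenböck formula for a harmonic one-form.
The action of `Π` on `K g` contributes `-8KX`, and the derivative of `K` reproduces `ρ(D)`. Hence
`ρ(∇) = ρ(D) - 12KX` (`IsAdaptedFrame.curvatureOneForm_deformedConnection`). The frame formulas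
apply to `D` itself by putting `X = 0`.

`∇` is symplectic because `Π_{ijk}` is totally symmetric. For constant `R_g` the form `ρ(D)`
vanishes, so `ρ(∇)` is a constant multiple of the closed form `X`. On a surface the two quadratic
terms of the moment map cancel for every connection (`curvatureSq_eq_ricciSq`), leaving a
contraction of `∇ρ` that sees only its skew part, which is zero
(`isMomentFlat_of_curvatureOneForm`). Finally, `Ric(∇)` is symmetric, so the Cotton tensor of `∇` is
`ρ(∇)` up to a constant factor; projective flatness therefore forces `R_g X = 0`. -/

noncomputable section

local notation "𝕋" => TangentSpace (modelWithCornersSelf ℝ (EuclideanSpace ℝ (Fin 2)))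

open scoped Topology
open Filter VectorField

namespace Surface

/-! ### Smooth functions and vector fields, cut-offs, Lie brackets -/

section SmoothFunctions

variable {M : Type*} [TopologicalSpace M] [ChartedSpace (EuclideanSpace ℝ (Fin 2)) M]

/-- Differentiability of a real function at a point. -/
abbrev FunDiffAt (f : M → ℝ) (x : M) : Prop :=
  MDifferentiableAt (𝓡 2) 𝓘(ℝ, ℝ) f x

/-- Smooth real functions on `M`. -/
abbrev IsSmoothFun (f : M → ℝ) : Prop := ContMDiff (𝓡 2) 𝓘(ℝ, ℝ) ∞ f

theorem IsSmoothFun.diffAt {f : M → ℝ} (hf : IsSmoothFun f) (x : M) : FunDiffAt f x :=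
  hf.mdifferentiableAt (by simp)

theorem isSmoothFun_const (c : ℝ) : IsSmoothFun fun _ : M ↦ c :=
  contMDiff_const

end SmoothFunctions

section SmoothFields

variable {M : Type*} [TopologicalSpace M] [ChartedSpace (EuclideanSpace ℝ (Fin 2)) M]
  [IsManifold (𝓡 2) ∞ M]

/-- Differentiability of a vector field at a point. -/
abbrev FieldDiffAt (Y : Π x : M, 𝕋 x) (x : M) : Prop :=
  MDifferentiableAt (𝓡 2) ((𝓡 2).prod 𝓘(ℝ, EuclideanSpace ℝ (Fin 2)))
    (fun x ↦ TotalSpace.mk' (EuclideanSpace ℝ (Fin 2)) (E := fun x : M ↦ 𝕋 x) x (Y x)) x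

theorem IsSmoothField.diffAt {Y : Π x : M, 𝕋 x} (hY : IsSmoothField Y) (x : M) :
    FieldDiffAt Y x :=
  hY.mdifferentiableAt (by simp)

theorem fieldDiffAt_field {x : M} (v : 𝕋 x) : FieldDiffAt (field v) x :=
  FiberBundle.mdifferentiableAt_extend ..

@[simp] theorem field_self {x : M} (v : 𝕋 x) : field v x = v :=
  FiberBundle.extend_apply_self ..

theorem IsSmoothField.add {Y Z : Π x : M, 𝕋 x} (hY : IsSmoothField Y) (hZ : IsSmoothField Z) :
    IsSmoothField (Y + Z) :=
  ContMDiff.add_section hY hZ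

theorem IsSmoothField.sub {Y Z : Π x : M, 𝕋 x} (hY : IsSmoothField Y) (hZ : IsSmoothField Z) :
    IsSmoothField (Y - Z) :=
  ContMDiff.sub_section hY hZ

theorem IsSmoothField.smul {f : M → ℝ} {Y : Π x : M, 𝕋 x} (hY : IsSmoothField Y)
    (hf : IsSmoothFun f) : IsSmoothField (f • Y) :=
  ContMDiff.smul_section hf hY

/-- A vector field that is smooth on a neighbourhood of a point agrees near the point with a
globally smooth one. -/
theorem exists_isSmoothField_eventuallyEq [T2Space M] {Y : Π x : M, 𝕋 x} {s : Set M} {x : M}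
    (hs : s ∈ 𝓝 x)
    (hY : ContMDiffOn (𝓡 2) ((𝓡 2).prod 𝓘(ℝ, EuclideanSpace ℝ (Fin 2))) ∞
      (fun x ↦ TotalSpace.mk' (EuclideanSpace ℝ (Fin 2)) (E := fun x : M ↦ 𝕋 x) x (Y x)) s) :
    ∃ Z : Π x : M, 𝕋 x, IsSmoothField Z ∧ ∀ᶠ y in 𝓝 x, Z y = Y y := by
  obtain ⟨u, hus, hu, hxu⟩ := mem_nhds_iff.1 hs
  obtain ⟨f, -, hf⟩ := (SmoothBumpFunction.nhds_basis_tsupport (I := 𝓡 2) x).mem_iff.1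
    (hu.mem_nhds hxu)
  refine ⟨(f : M → ℝ) • Y, ?_, ?_⟩
  · exact ContMDiffOn.smul_section_of_tsupport f.contMDiff.contMDiffOn hu hf (hY.mono hus)
  · filter_upwards [f.eventuallyEq_one] with y hy
    simp [hy]

/-- The tensors are defined through `field v`, which is smooth only near the base point, whereas the
calculus below is run with globally smooth fields. This is the passage between the two. -/
theorem exists_isSmoothField_eq_field [T2Space M] {x : M} (v : 𝕋 x) :
    ∃ Z : Π x : M, 𝕋 x, IsSmoothField Z ∧ (∀ᶠ y in 𝓝 x, Z y = field v y) ∧ Z x = v := by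
  obtain ⟨s, hs, h⟩ := FiberBundle.exists_contMDiffOn_extend (k := ∞) (𝓡 2)
    (EuclideanSpace ℝ (Fin 2)) (V := fun x : M ↦ 𝕋 x) v
  obtain ⟨Z, hZ, hZs⟩ := exists_isSmoothField_eventuallyEq hs h
  exact ⟨Z, hZ, hZs, by simpa using hZs.self_of_nhds⟩

/-- The derivative of a smooth function along a smooth vector field is smooth. -/
theorem IsSmoothFun.derivAlong {f : M → ℝ} {Y : Π x : M, 𝕋 x} (hf : IsSmoothFun f)
    (hY : IsSmoothField Y) : IsSmoothFun fun y ↦ mvfderiv (𝓡 2) f y (Y y) := by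
  have h1 : ContMDiff (𝓡 2).tangent 𝓘(ℝ, ℝ).tangent ∞ (tangentMap (𝓡 2) 𝓘(ℝ, ℝ) f) :=
    hf.contMDiff_tangentMap (m := ∞) (by simp)
  exact (contMDiff_snd_tangentBundle_modelSpace ℝ 𝓘(ℝ, ℝ)).comp (h1.comp hY)

theorem IsSmoothField.mlieBracket {Y Z : Π x : M, 𝕋 x} (hY : IsSmoothField Y)
    (hZ : IsSmoothField Z) : IsSmoothField (VectorField.mlieBracket (𝓡 2) Y Z) := by
  have : IsManifold (𝓡 2) (minSmoothness ℝ 2) M := by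
    rw [minSmoothness_of_isRCLikeNormedField]; infer_instance
  have : IsManifold (𝓡 2) (((⊤ : ℕ∞) : ℕ∞ω) + 1) M := by simpa using ‹IsManifold (𝓡 2) ∞ M›
  exact fun x ↦ ContMDiffAt.mlieBracket_vectorField (m := ⊤) (n := ⊤) (hY x) (hZ x) (by simp)

/-- The commutator of derivations is the derivation along the Lie bracket. -/
theorem mvfderiv_mlieBracket [T2Space M] {f : M → ℝ} {U V : Π x : M, 𝕋 x} (hf : IsSmoothFun f)
    (hU : IsSmoothField U) (hV : IsSmoothField V) (x : M) :
    mvfderiv (𝓡 2) f x (VectorField.mlieBracket (𝓡 2) U V x) =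
      mvfderiv (𝓡 2) (fun y ↦ mvfderiv (𝓡 2) f y (V y)) x (U x)
        - mvfderiv (𝓡 2) (fun y ↦ mvfderiv (𝓡 2) f y (U y)) x (V x) := by
  have : IsManifold (𝓡 2) (minSmoothness ℝ 2) M := by
    rw [minSmoothness_of_isRCLikeNormedField]; infer_instance
  have : IsManifold (𝓡 2) (minSmoothness ℝ 3) M := by
    rw [minSmoothness_of_isRCLikeNormedField]; infer_instance
  obtain ⟨W, hW, -, hWx⟩ := exists_isSmoothField_eq_field (basis x 0)
  have hUf := hf.derivAlong hU
  have hVf := hf.derivAlong hV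
  have hle : minSmoothness ℝ 2 ≤ ∞ := by
    rw [minSmoothness_of_isRCLikeNormedField]; exact ENat.LEInfty.out
  -- Compare the Jacobi identity for `f • W` with `f` times the one for `W`. First-order terms in
  -- `f` cancel, and what survives is the commutator defect of `f` times `W`; since `W x ≠ 0`, the
  -- defect vanishes.
  have jac {Z : Π x : M, 𝕋 x} (hZ : IsSmoothField Z) :=
    leibniz_identity_mlieBracket_apply (x := x) ((hU x).of_le hle) ((hV x).of_le hle)
      ((hZ x).of_le hle)
  have e {Y : Π x : M, 𝕋 x} : VectorField.mlieBracket (𝓡 2) Y (f • W) =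
      (fun y ↦ mvfderiv (𝓡 2) f y (Y y)) • W + f • VectorField.mlieBracket (𝓡 2) Y W :=
    funext fun y ↦ mlieBracket_smul_right (hf.diffAt y) (hW.diffAt y)
  have hUW := hU.mlieBracket hW
  have hVW := hV.mlieBracket hW
  have h := jac (hW.smul hf)
  rw [e, e, e, mlieBracket_add_right ((hW.smul hVf).diffAt x) ((hVW.smul hf).diffAt x),
    mlieBracket_add_right ((hW.smul hUf).diffAt x) ((hUW.smul hf).diffAt x),
    mlieBracket_smul_right (hVf.diffAt x) (hW.diffAt x),
    mlieBracket_smul_right (hUf.diffAt x) (hW.diffAt x),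
    mlieBracket_smul_right (hf.diffAt x) (hVW.diffAt x),
    mlieBracket_smul_right (hf.diffAt x) (hUW.diffAt x), jac hW] at h
  have h0 : (mvfderiv (𝓡 2) (fun y ↦ mvfderiv (𝓡 2) f y (V y)) x (U x)
        - mvfderiv (𝓡 2) (fun y ↦ mvfderiv (𝓡 2) f y (U y)) x (V x)
        - mvfderiv (𝓡 2) f x (VectorField.mlieBracket (𝓡 2) U V x)) • W x = 0 := by
    simp only [Pi.add_apply, Pi.smul_apply'] at h
    rw [← sub_eq_zero.2 h]
    module
  rcases smul_eq_zero.1 h0 with h1 | h1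
  · linarith
  · exact absurd (hWx ▸ h1) ((basis x).ne_zero 0)

end SmoothFields

/-! ### Adapted orthonormal frames -/

section Frames

variable {M : Type*} [TopologicalSpace M] [ChartedSpace (EuclideanSpace ℝ (Fin 2)) M]
  [IsManifold (𝓡 2) ∞ M] [RiemannianBundle (fun x : M ↦ TangentSpace (𝓡 2) x)]

/-- Smooth vector fields `E 0`, `E 1` which on the open set `U` form an orthonormal frame with
`J (E 0) = E 1`. -/
structure IsAdaptedFrame (J : Π x : M, 𝕋 x →L[ℝ] 𝕋 x) (E : Fin 2 → Π x : M, 𝕋 x) (U : Set M) :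
    Prop where
  isOpen : IsOpen U
  smooth : ∀ a, IsSmoothField (E a)
  inner_zero_zero : ∀ y ∈ U, inner ℝ (E 0 y) (E 0 y) = 1
  map_zero : ∀ y ∈ U, J y (E 0 y) = E 1 y

theorem IsKahler.smooth_apply {J : Π x : M, 𝕋 x →L[ℝ] 𝕋 x} (hJ : IsKahler J)
    {Y : Π x : M, 𝕋 x} (hY : IsSmoothField Y) : IsSmoothField fun y ↦ J y (Y y) :=
  ContMDiff.clm_bundle_apply (F₁ := EuclideanSpace ℝ (Fin 2)) (F₂ := EuclideanSpace ℝ (Fin 2))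
    hJ.smooth hY

theorem IsKahler.inner_apply_self {J : Π x : M, 𝕋 x →L[ℝ] 𝕋 x} (hJ : IsKahler J)
    {x : M} (u : 𝕋 x) : inner ℝ (J x u) u = 0 := by
  have h := hJ.hermitian x (J x u) u
  rw [hJ.sq, inner_neg_left, real_inner_comm] at h
  linarith

namespace IsAdaptedFrame

variable {J : Π x : M, 𝕋 x →L[ℝ] 𝕋 x} {E : Fin 2 → Π x : M, 𝕋 x} {U : Set M} {y : M}

theorem inner_one_one (hE : IsAdaptedFrame J E U) (hJ : IsKahler J) (hy : y ∈ U) :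
    inner ℝ (E 1 y) (E 1 y) = 1 := by
  rw [← hE.map_zero y hy, hJ.hermitian, hE.inner_zero_zero y hy]

theorem inner_one_zero (hE : IsAdaptedFrame J E U) (hJ : IsKahler J) (hy : y ∈ U) :
    inner ℝ (E 1 y) (E 0 y) = 0 := by
  rw [← hE.map_zero y hy, hJ.inner_apply_self]

theorem inner_zero_one (hE : IsAdaptedFrame J E U) (hJ : IsKahler J) (hy : y ∈ U) :
    inner ℝ (E 0 y) (E 1 y) = 0 := by
  rw [real_inner_comm, hE.inner_one_zero hJ hy]

/-- The expansion of a tangent vector in an adapted frame. -/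
theorem expand (hE : IsAdaptedFrame J E U) (hJ : IsKahler J) (hy : y ∈ U) (v : 𝕋 y) :
    v = inner ℝ v (E 0 y) • E 0 y + inner ℝ v (E 1 y) • E 1 y := by
  have hon : Orthonormal ℝ fun a ↦ E a y := by
    rw [orthonormal_iff_ite]
    intro a b
    fin_cases a <;> fin_cases b
    exacts [hE.inner_zero_zero y hy, hE.inner_zero_one hJ hy, hE.inner_one_zero hJ hy,
      hE.inner_one_one hJ hy]
  have hcard : Fintype.card (Fin 2) = Module.finrank ℝ (𝕋 y) := by
    rw [Module.finrank_eq_card_basis (basis y)]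
  have hspan := (basisOfOrthonormalOfCardEqFinrank hon hcard).sum_repr v
  rw [Fin.sum_univ_two, coe_basisOfOrthonormalOfCardEqFinrank] at hspan
  generalize (basisOfOrthonormalOfCardEqFinrank hon hcard).repr v = c at hspan
  rw [← hspan]
  simp only [inner_add_left, real_inner_smul_left, hE.inner_zero_zero y hy,
    hE.inner_zero_one hJ hy, hE.inner_one_zero hJ hy, hE.inner_one_one hJ hy]
  simp

end IsAdaptedFrame

variable [IsContMDiffRiemannianBundle (𝓡 2) ∞ (EuclideanSpace ℝ (Fin 2))
  (fun x : M ↦ TangentSpace (𝓡 2) x)]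

theorem IsSmoothField.inner {Y Z : Π x : M, 𝕋 x} (hY : IsSmoothField Y) (hZ : IsSmoothField Z) :
    IsSmoothFun fun y ↦ inner ℝ (Y y) (Z y) :=
  ContMDiff.inner_bundle hY hZ

theorem FieldDiffAt.inner {Y Z : Π x : M, 𝕋 x} {x : M} (hY : FieldDiffAt Y x)
    (hZ : FieldDiffAt Z x) : FunDiffAt (fun y ↦ inner ℝ (Y y) (Z y)) x :=
  have : IsContMDiffRiemannianBundle (𝓡 2) 1 (EuclideanSpace ℝ (Fin 2))
      (fun x : M ↦ TangentSpace (𝓡 2) x) :=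
    IsContMDiffRiemannianBundle.of_le (n := ∞) (by simp)
  MDifferentiableAt.inner_bundle hY hZ

/-- Normalize a field that is nonzero at `x`, which is smooth only where its norm is positive, and
cut it off. The fields are then globally smooth, and orthonormality holds only on `U`. Applying `J`
supplies the second vector. -/
theorem exists_isAdaptedFrame [T2Space M] {J : Π x : M, 𝕋 x →L[ℝ] 𝕋 x} (hJ : IsKahler J) (x : M) :
    ∃ (E : Fin 2 → Π x : M, 𝕋 x) (U : Set M), x ∈ U ∧ IsAdaptedFrame J E U := by
  obtain ⟨V, hV, -, hVx⟩ := exists_isSmoothField_eq_field (basis x 0)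
  have hh := hV.inner hV
  have hpos : IsOpen {y | 0 < inner ℝ (V y) (V y)} := isOpen_lt continuous_const hh.continuous
  have hx : 0 < inner ℝ (V x) (V x) := by
    rw [real_inner_self_pos, hVx]
    exact (basis x).ne_zero 0
  obtain ⟨Z, hZ, hZV⟩ := exists_isSmoothField_eventuallyEq
    (Y := (fun y ↦ (√(inner ℝ (V y) (V y)))⁻¹) • V) (hpos.mem_nhds hx) (by
      refine ContMDiffOn.smul_section (fun y hy ↦ ?_) hV.contMDiffOn
      have h1 : ContDiffAt ℝ ∞ (fun t : ℝ ↦ (√t)⁻¹) (inner ℝ (V y) (V y)) :=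
        (Real.contDiffAt_sqrt (ne_of_gt hy)).inv (Real.sqrt_ne_zero'.2 hy)
      exact (h1.contMDiffAt.comp y (hh y)).contMDiffWithinAt)
  obtain ⟨U, hU, hUo, hxU⟩ := eventually_nhds_iff.1 (hZV.and (hpos.mem_nhds hx))
  refine ⟨![Z, fun y ↦ J y (Z y)], U, hxU, hUo, ?_, fun y hy ↦ ?_, fun y hy ↦ rfl⟩
  · intro a
    fin_cases a
    exacts [hZ, hJ.smooth_apply hZ]
  · obtain ⟨h1, h2⟩ := hU y hy
    have h3 : √(inner ℝ (V y) (V y)) ≠ 0 := Real.sqrt_ne_zero'.2 h2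
    simp only [Matrix.cons_val_zero, h1, Pi.smul_apply', inner_smul_left, inner_smul_right]
    simp only [conj_trivial]
    field_simp
    exact (Real.sq_sqrt h2.le).symm

end Frames

/-! ### Tensoriality of the curvature; the Ricci trace in a frame -/

section Curvature

variable {M : Type*} [TopologicalSpace M] [ChartedSpace (EuclideanSpace ℝ (Fin 2)) M]
  [IsManifold (𝓡 2) ∞ M] {D : AffineConnection M}

theorem cov_add_apply (D : AffineConnection M) {Y Z : Π x : M, 𝕋 x} {x : M}
    (hY : FieldDiffAt Y x) (hZ : FieldDiffAt Z x) (u : 𝕋 x) :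
    D (Y + Z) x u = D Y x u + D Z x u := by
  rw [D.isCovariantDerivativeOnUniv.add hY hZ]
  rfl

theorem cov_smul_apply (D : AffineConnection M) {f : M → ℝ} {Y : Π x : M, 𝕋 x} {x : M}
    (hf : FunDiffAt f x) (hY : FieldDiffAt Y x) (u : 𝕋 x) :
    D (f • Y) x u = f x • D Y x u + mvfderiv (𝓡 2) f x u • Y x := by
  rw [D.isCovariantDerivativeOnUniv.leibniz hY hf]
  rfl

theorem cov_congr (D : AffineConnection M) {Y Z : Π x : M, 𝕋 x} {x : M}
    (hZ : FieldDiffAt Z x) (h : ∀ᶠ y in 𝓝 x, Y y = Z y) : D Y x = D Z x := by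
  refine D.isCovariantDerivativeOnUniv.congr_of_eventuallyEq ?_ hZ univ_mem h
  exact hZ.congr_of_eventuallyEq (h.mono fun y hy ↦ by simp only [hy])

theorem FieldDiffAt.add {Y Z : Π x : M, 𝕋 x} {x : M} (hY : FieldDiffAt Y x)
    (hZ : FieldDiffAt Z x) : FieldDiffAt (Y + Z) x :=
  mdifferentiableAt_add_section hY hZ

theorem FieldDiffAt.smul {f : M → ℝ} {Y : Π x : M, 𝕋 x} {x : M} (hY : FieldDiffAt Y x)
    (hf : FunDiffAt f x) : FieldDiffAt (f • Y) x :=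
  MDifferentiableAt.smul_section hf hY

theorem IsSmoothField.cov (hD : CovariantDerivative.ContMDiffCovariantDerivative D ∞)
    {V W : Π x : M, 𝕋 x} (hW : IsSmoothField W) (hV : IsSmoothField V) :
    IsSmoothField fun y ↦ D W y (V y) := by
  have h := hD.contMDiff.contMDiff (σ := W) (by simpa using hW.contMDiffOn)
  rw [contMDiffOn_univ] at h
  exact ContMDiff.clm_bundle_apply (F₁ := EuclideanSpace ℝ (Fin 2))
    (F₂ := EuclideanSpace ℝ (Fin 2)) h hV

theorem FieldDiffAt.cov (hD : CovariantDerivative.ContMDiffCovariantDerivative D ∞)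
    {V W : Π x : M, 𝕋 x} {x : M} (hV : FieldDiffAt V x) (hW : IsSmoothField W) :
    FieldDiffAt (fun y ↦ D W y (V y)) x := by
  have h := hD.contMDiff.contMDiff (σ := W) (by simpa using hW.contMDiffOn)
  rw [contMDiffOn_univ] at h
  exact MDifferentiableAt.clm_bundle_apply (F₁ := EuclideanSpace ℝ (Fin 2))
    (F₂ := EuclideanSpace ℝ (Fin 2)) (h.mdifferentiableAt (by simp)) hV

/-- The curvature operator `∇_U ∇_V W - ∇_V ∇_U W - ∇_{[U, V]} W` on vector fields. -/
def fieldCurvature (D : AffineConnection M) (U V W : Π x : M, 𝕋 x) (x : M) : 𝕋 x :=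
  D (fun y ↦ D W y (V y)) x (U x) - D (fun y ↦ D W y (U y)) x (V x)
    - D W x (mlieBracket (𝓡 2) U V x)

theorem curvature_eq_fieldCurvature_field (D : AffineConnection M) (x : M) (u v w : 𝕋 x) :
    curvature D x u v w = fieldCurvature D (field u) (field v) (field w) x := by
  simp only [curvature, fieldCurvature, field_self]

theorem fieldCurvature_swap (D : AffineConnection M) (U V W : Π x : M, 𝕋 x) (x : M) :
    fieldCurvature D U V W x = -fieldCurvature D V U W x := by
  simp only [fieldCurvature]
  rw [mlieBracket_swap_apply (V := U), map_neg]
  abel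

theorem curvature_swap (D : AffineConnection M) (x : M) (u v w : 𝕋 x) :
    curvature D x u v w = -curvature D x v u w := by
  simp only [curvature_eq_fieldCurvature_field]
  exact fieldCurvature_swap ..

/-- The derivative of `f` along `U` produced by `∇_U (f ∇_V W)` is cancelled by the one in `[U,
fV]`. The slot of `U` then follows by antisymmetry. -/
theorem tensorialAt_fieldCurvature (hD : CovariantDerivative.ContMDiffCovariantDerivative D ∞)
    (U : Π x : M, 𝕋 x) {W : Π x : M, 𝕋 x} {x : M} (hW : IsSmoothField W) :
    TensorialAt (𝓡 2) (EuclideanSpace ℝ (Fin 2)) (fun V ↦ fieldCurvature D U V W x) x where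
  smul {f V} hf hV := by
    have e : (fun y ↦ D W y ((f • V) y)) = f • fun y ↦ D W y (V y) := by
      ext y : 1
      simp
    simp only [fieldCurvature]
    rw [e, cov_smul_apply D hf (FieldDiffAt.cov hD hV hW), mlieBracket_smul_right hf hV]
    simp only [map_add, map_smul, Pi.smul_apply']
    module
  add {V V'} hV hV' := by
    have e : (fun y ↦ D W y ((V + V') y)) = (fun y ↦ D W y (V y)) + fun y ↦ D W y (V' y) := by
      ext y : 1
      simp
    simp only [fieldCurvature]
    rw [e, cov_add_apply D (FieldDiffAt.cov hD hV hW) (FieldDiffAt.cov hD hV' hW),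
      mlieBracket_add_right hV hV']
    simp only [map_add, Pi.add_apply]
    module

theorem fieldCurvature_pointwise (hD : CovariantDerivative.ContMDiffCovariantDerivative D ∞)
    {U U' V V' W : Π x : M, 𝕋 x} {x : M} (hW : IsSmoothField W) (hU : FieldDiffAt U x)
    (hV : FieldDiffAt V x) (hU' : FieldDiffAt U' x) (hV' : FieldDiffAt V' x)
    (hUU' : U x = U' x) (hVV' : V x = V' x) :
    fieldCurvature D U V W x = fieldCurvature D U' V' W x := by
  rw [(tensorialAt_fieldCurvature hD U hW).pointwise hV hV' hVV', fieldCurvature_swap,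
    (tensorialAt_fieldCurvature hD V' hW).pointwise hU hU' hUU', ← fieldCurvature_swap]

theorem fieldCurvature_congr_right (hD : CovariantDerivative.ContMDiffCovariantDerivative D ∞)
    {U V W W' : Π x : M, 𝕋 x} {x : M}
    (hU : FieldDiffAt U x) (hV : FieldDiffAt V x) (hW' : IsSmoothField W')
    (h : ∀ᶠ y in 𝓝 x, W y = W' y) :
    fieldCurvature D U V W x = fieldCurvature D U V W' x := by
  have h1 : ∀ᶠ y in 𝓝 x, D W y = D W' y :=
    h.eventually_nhds.mono fun y hy ↦ cov_congr D (hW'.diffAt y) hy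
  have h2 {Y : Π x : M, 𝕋 x} (hY : FieldDiffAt Y x) :
      D (fun y ↦ D W y (Y y)) x = D (fun y ↦ D W' y (Y y)) x :=
    cov_congr D (hY.cov hD hW') (h1.mono fun y hy ↦ by rw [hy])
  simp only [fieldCurvature]
  rw [h2 hU, h2 hV, h1.self_of_nhds]

theorem fieldCurvature_add_right (hD : CovariantDerivative.ContMDiffCovariantDerivative D ∞)
    {U V W Z : Π x : M, 𝕋 x} (x : M) (hU : IsSmoothField U) (hV : IsSmoothField V)
    (hW : IsSmoothField W) (hZ : IsSmoothField Z) :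
    fieldCurvature D U V (W + Z) x = fieldCurvature D U V W x + fieldCurvature D U V Z x := by
  have e (Y : Π x : M, 𝕋 x) : (fun y ↦ D (W + Z) y (Y y)) =
      (fun y ↦ D W y (Y y)) + fun y ↦ D Z y (Y y) :=
    funext fun y ↦ cov_add_apply D (hW.diffAt y) (hZ.diffAt y) _
  simp only [fieldCurvature]
  rw [e, e, cov_add_apply D ((hW.cov hD hV).diffAt x) ((hZ.cov hD hV).diffAt x),
    cov_add_apply D ((hW.cov hD hU).diffAt x) ((hZ.cov hD hU).diffAt x),
    cov_add_apply D (hW.diffAt x) (hZ.diffAt x)]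
  abel

/-- The first-order cross terms cancel in pairs, and the second-order terms `UVf - VUf - [U,V]f`
vanish by `mvfderiv_mlieBracket`. -/
theorem fieldCurvature_smul_right [T2Space M]
    (hD : CovariantDerivative.ContMDiffCovariantDerivative D ∞) {f : M → ℝ}
    {U V W : Π x : M, 𝕋 x} (x : M) (hf : IsSmoothFun f) (hU : IsSmoothField U)
    (hV : IsSmoothField V) (hW : IsSmoothField W) :
    fieldCurvature D U V (f • W) x = f x • fieldCurvature D U V W x := by
  have e (Y : Π x : M, 𝕋 x) : (fun y ↦ D (f • W) y (Y y)) =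
      (f • fun y ↦ D W y (Y y)) + (fun y ↦ mvfderiv (𝓡 2) f y (Y y)) • W :=
    funext fun y ↦ cov_smul_apply D (hf.diffAt y) (hW.diffAt y) _
  have hfU := hf.derivAlong hU
  have hfV := hf.derivAlong hV
  have hWU := hW.cov hD hU
  have hWV := hW.cov hD hV
  simp only [fieldCurvature]
  rw [e, e, cov_add_apply D ((hWV.smul hf).diffAt x) ((hW.smul hfV).diffAt x),
    cov_add_apply D ((hWU.smul hf).diffAt x) ((hW.smul hfU).diffAt x),
    cov_smul_apply D (hf.diffAt x) (hWV.diffAt x), cov_smul_apply D (hf.diffAt x) (hWU.diffAt x),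
    cov_smul_apply D (hfV.diffAt x) (hW.diffAt x), cov_smul_apply D (hfU.diffAt x) (hW.diffAt x),
    cov_smul_apply D (hf.diffAt x) (hW.diffAt x), mvfderiv_mlieBracket hf hU hV]
  module

variable [RiemannianBundle (fun x : M ↦ TangentSpace (𝓡 2) x)]
  [IsContMDiffRiemannianBundle (𝓡 2) ∞ (EuclideanSpace ℝ (Fin 2))
  (fun x : M ↦ TangentSpace (𝓡 2) x)] {J : Π x : M, 𝕋 x →L[ℝ] 𝕋 x}

/-- Near `x` the field `W` is a combination of frame fields whose coefficients vanish at `x`, and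
linearity over functions pulls the coefficients out. -/
theorem fieldCurvature_eq_zero [T2Space M] (hJ : IsKahler J)
    (hD : CovariantDerivative.ContMDiffCovariantDerivative D ∞)
    {U V W : Π x : M, 𝕋 x} {x : M} (hU : IsSmoothField U)
    (hV : IsSmoothField V) (hW : IsSmoothField W) (hWx : W x = 0) :
    fieldCurvature D U V W x = 0 := by
  obtain ⟨E, s, hxs, hE⟩ := exists_isAdaptedFrame hJ x
  have hf (a) := hW.inner (hE.smooth a)
  have hWE : ∀ᶠ y in 𝓝 x, W y =
      ((fun y ↦ inner ℝ (W y) (E 0 y)) • E 0 + (fun y ↦ inner ℝ (W y) (E 1 y)) • E 1) y :=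
    Filter.eventually_of_mem (hE.isOpen.mem_nhds hxs) fun y hy ↦ hE.expand hJ hy (W y)
  rw [fieldCurvature_congr_right hD (hU.diffAt x) (hV.diffAt x)
    (((hE.smooth 0).smul (hf 0)).add ((hE.smooth 1).smul (hf 1))) hWE,
    fieldCurvature_add_right hD x hU hV ((hE.smooth 0).smul (hf 0)) ((hE.smooth 1).smul (hf 1)),
    fieldCurvature_smul_right hD x (hf 0) hU hV (hE.smooth 0),
    fieldCurvature_smul_right hD x (hf 1) hU hV (hE.smooth 1)]
  simp [hWx]

/-- The curvature tensor is given by the curvature operator on any smooth vector fields. -/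
theorem curvature_apply [T2Space M] (hJ : IsKahler J)
    (hD : CovariantDerivative.ContMDiffCovariantDerivative D ∞)
    {U V W : Π x : M, 𝕋 x} (x : M) (hU : IsSmoothField U)
    (hV : IsSmoothField V) (hW : IsSmoothField W) :
    curvature D x (U x) (V x) (W x) = fieldCurvature D U V W x := by
  obtain ⟨Z, hZ, hZW, hZx⟩ := exists_isSmoothField_eq_field (W x)
  rw [curvature_eq_fieldCurvature_field, fieldCurvature_congr_right hD (fieldDiffAt_field _)
    (fieldDiffAt_field _) hZ (hZW.mono fun _ h ↦ h.symm),
    fieldCurvature_pointwise hD hZ (fieldDiffAt_field _) (fieldDiffAt_field _) (hU.diffAt x)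
      (hV.diffAt x) (field_self _) (field_self _)]
  -- `Z` and `W` agree at `x`, so their difference contributes nothing to the curvature there.
  have hd := hZ.sub hW
  have h := fieldCurvature_add_right hD x hU hV hW hd
  rw [fieldCurvature_eq_zero hJ hD hU hV hd (by simp [hZx]), add_sub_cancel, add_zero] at h
  exact h

theorem curvature_add_middle [T2Space M] (hJ : IsKahler J)
    (hD : CovariantDerivative.ContMDiffCovariantDerivative D ∞) (x : M) (u v v' w : 𝕋 x) :
    curvature D x u (v + v') w = curvature D x u v w + curvature D x u v' w := by
  obtain ⟨U, hU, -, rfl⟩ := exists_isSmoothField_eq_field u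
  obtain ⟨V, hV, -, rfl⟩ := exists_isSmoothField_eq_field v
  obtain ⟨V', hV', -, rfl⟩ := exists_isSmoothField_eq_field v'
  obtain ⟨W, hW, -, rfl⟩ := exists_isSmoothField_eq_field w
  rw [← Pi.add_apply V, curvature_apply hJ hD x hU (hV.add hV') hW, curvature_apply hJ hD x hU hV hW,
    curvature_apply hJ hD x hU hV' hW]
  exact (tensorialAt_fieldCurvature hD U hW).add (hV.diffAt x) (hV'.diffAt x)

theorem curvature_smul_middle [T2Space M] (hJ : IsKahler J)
    (hD : CovariantDerivative.ContMDiffCovariantDerivative D ∞) (x : M) (c : ℝ) (u v w : 𝕋 x) :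
    curvature D x u (c • v) w = c • curvature D x u v w := by
  obtain ⟨U, hU, -, rfl⟩ := exists_isSmoothField_eq_field u
  obtain ⟨V, hV, -, rfl⟩ := exists_isSmoothField_eq_field v
  obtain ⟨W, hW, -, rfl⟩ := exists_isSmoothField_eq_field w
  have hc := isSmoothFun_const (M := M) c
  have := curvature_apply hJ hD x hU (hV.smul hc) hW
  rw [curvature_apply hJ hD x hU hV hW]
  refine this.trans ?_
  exact (tensorialAt_fieldCurvature hD U hW).smul (hc.diffAt x) (hV.diffAt x)

theorem curvature_add_right [T2Space M] (hJ : IsKahler J)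
    (hD : CovariantDerivative.ContMDiffCovariantDerivative D ∞) (x : M) (u v w w' : 𝕋 x) :
    curvature D x u v (w + w') = curvature D x u v w + curvature D x u v w' := by
  obtain ⟨U, hU, -, rfl⟩ := exists_isSmoothField_eq_field u
  obtain ⟨V, hV, -, rfl⟩ := exists_isSmoothField_eq_field v
  obtain ⟨W, hW, -, rfl⟩ := exists_isSmoothField_eq_field w
  obtain ⟨W', hW', -, rfl⟩ := exists_isSmoothField_eq_field w'
  rw [← Pi.add_apply W, curvature_apply hJ hD x hU hV (hW.add hW'), curvature_apply hJ hD x hU hV hW,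
    curvature_apply hJ hD x hU hV hW']
  exact fieldCurvature_add_right hD x hU hV hW hW'

theorem curvature_smul_right [T2Space M] (hJ : IsKahler J)
    (hD : CovariantDerivative.ContMDiffCovariantDerivative D ∞) (x : M) (c : ℝ) (u v w : 𝕋 x) :
    curvature D x u v (c • w) = c • curvature D x u v w := by
  obtain ⟨U, hU, -, rfl⟩ := exists_isSmoothField_eq_field u
  obtain ⟨V, hV, -, rfl⟩ := exists_isSmoothField_eq_field v
  obtain ⟨W, hW, -, rfl⟩ := exists_isSmoothField_eq_field w
  have hc := isSmoothFun_const (M := M) c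
  have := curvature_apply hJ hD x hU hV (hW.smul hc)
  rw [curvature_apply hJ hD x hU hV hW]
  refine this.trans ?_
  exact fieldCurvature_smul_right hD x hc hU hV hW

theorem curvature_add_left [T2Space M] (hJ : IsKahler J)
    (hD : CovariantDerivative.ContMDiffCovariantDerivative D ∞) (x : M) (u u' v w : 𝕋 x) :
    curvature D x (u + u') v w = curvature D x u v w + curvature D x u' v w := by
  rw [curvature_swap, curvature_add_middle hJ hD, curvature_swap D x u, curvature_swap D x u']
  abel

theorem curvature_smul_left [T2Space M] (hJ : IsKahler J)
    (hD : CovariantDerivative.ContMDiffCovariantDerivative D ∞) (x : M) (c : ℝ) (u v w : 𝕋 x) :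
    curvature D x (c • u) v w = c • curvature D x u v w := by
  rw [curvature_swap, curvature_smul_middle hJ hD, curvature_swap D x u, smul_neg]

/-- The Ricci curvature as a trace over an adapted frame. -/
theorem ricci_eq_frame [T2Space M] (hJ : IsKahler J)
    (hD : CovariantDerivative.ContMDiffCovariantDerivative D ∞) {E : Fin 2 → Π x : M, 𝕋 x}
    {s : Set M} (hE : IsAdaptedFrame J E s) {x : M} (hx : x ∈ s) (v w : 𝕋 x) :
    ricci D x v w = inner ℝ (curvature D x (E 0 x) v w) (E 0 x)
      + inner ℝ (curvature D x (E 1 x) v w) (E 1 x) := by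
  set b := basis x
  -- Independence of the trace from the basis: `hL` expands coordinate vectors in the frame and `hR`
  -- expands inner products in coordinates, which makes both sides the same double sum.
  have hL (p : Fin 2) : curvature D x (b p) v w =
      inner ℝ (b p) (E 0 x) • curvature D x (E 0 x) v w
        + inner ℝ (b p) (E 1 x) • curvature D x (E 1 x) v w := by
    conv_lhs => rw [hE.expand hJ hx (b p)]
    rw [curvature_add_left hJ hD, curvature_smul_left hJ hD, curvature_smul_left hJ hD]
  have hR (u e : 𝕋 x) :
      inner ℝ u e = b.repr u 0 * inner ℝ (b 0) e + b.repr u 1 * inner ℝ (b 1) e := by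
    conv_lhs => rw [← b.sum_repr u]
    rw [Fin.sum_univ_two, inner_add_left, real_inner_smul_left, real_inner_smul_left]
  rw [hR (curvature D x (E 0 x) v w), hR (curvature D x (E 1 x) v w), ricci, Fin.sum_univ_two,
    hL, hL]
  simp only [map_add, map_smul, Finsupp.add_apply, Finsupp.smul_apply, smul_eq_mul]
  ring

theorem isBilinearMap_ricci [T2Space M] (hJ : IsKahler J)
    (hD : CovariantDerivative.ContMDiffCovariantDerivative D ∞) (x : M) :
    IsBilinearMap ℝ (ricci D x) where
  add_left u v w := by
    simp [ricci, curvature_add_middle hJ hD, Finset.sum_add_distrib]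
  smul_left c v w := by
    simp [ricci, curvature_smul_middle hJ hD, mul_add]
  add_right u v w := by
    simp [ricci, curvature_add_right hJ hD, Finset.sum_add_distrib]
  smul_right c v w := by
    simp [ricci, curvature_smul_right hJ hD, mul_add]

end Curvature

/-! ### The Kähler form, contractions and covariant derivatives of two-tensors -/

section KahlerForm

variable {M : Type*} [TopologicalSpace M] [ChartedSpace (EuclideanSpace ℝ (Fin 2)) M]
  [RiemannianBundle (fun x : M ↦ TangentSpace (𝓡 2) x)]

theorem kahlerForm_apply (J : Π x : M, 𝕋 x →L[ℝ] 𝕋 x) (x : M) (u v : 𝕋 x) :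
    kahlerForm J x u v = inner ℝ (J x u) v := rfl

theorem isBilinearMap_kahlerForm (J : Π x : M, 𝕋 x →L[ℝ] 𝕋 x) (x : M) :
    IsBilinearMap ℝ fun u v ↦ kahlerForm J x u v where
  add_left u v w := by simp
  smul_left c v w := by simp
  add_right u v w := by simp
  smul_right c v w := by simp

end KahlerForm

section Tensors

variable {M : Type*} [TopologicalSpace M] [ChartedSpace (EuclideanSpace ℝ (Fin 2)) M]
  [IsManifold (𝓡 2) ∞ M] [RiemannianBundle (fun x : M ↦ TangentSpace (𝓡 2) x)]
  {J : Π x : M, 𝕋 x →L[ℝ] 𝕋 x}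

theorem IsAdaptedFrame.bilin_expand {E : Fin 2 → Π x : M, 𝕋 x} {s : Set M}
    (hE : IsAdaptedFrame J E s) (hJ : IsKahler J) {x : M} (hx : x ∈ s) {f : 𝕋 x → 𝕋 x → ℝ}
    (hf : IsBilinearMap ℝ f) (v w : 𝕋 x) :
    f v w = inner ℝ v (E 0 x) * inner ℝ w (E 0 x) * f (E 0 x) (E 0 x)
      + inner ℝ v (E 0 x) * inner ℝ w (E 1 x) * f (E 0 x) (E 1 x)
      + inner ℝ v (E 1 x) * inner ℝ w (E 0 x) * f (E 1 x) (E 0 x)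
      + inner ℝ v (E 1 x) * inner ℝ w (E 1 x) * f (E 1 x) (E 1 x) := by
  conv_lhs => rw [hE.expand hJ hx v, hE.expand hJ hx w]
  simp only [hf.add_left, hf.add_right, hf.smul_left, hf.smul_right, smul_eq_mul]
  ring

theorem IsKahler.kahlerForm_swap (hJ : IsKahler J) (x : M) (u v : 𝕋 x) :
    kahlerForm J x u v = -kahlerForm J x v u := by
  rw [kahlerForm_apply, kahlerForm_apply, ← hJ.hermitian x (J x u), hJ.sq, inner_neg_left,
    real_inner_comm]

theorem IsKahler.kahlerForm_self (hJ : IsKahler J) (x : M) (u : 𝕋 x) :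
    kahlerForm J x u u = 0 := by
  rw [kahlerForm_apply, hJ.inner_apply_self]

theorem IsAdaptedFrame.kahlerForm_zero_one {E : Fin 2 → Π x : M, 𝕋 x} {s : Set M}
    (hE : IsAdaptedFrame J E s) (hJ : IsKahler J) {x : M} (hx : x ∈ s) :
    kahlerForm J x (E 0 x) (E 1 x) = 1 := by
  rw [kahlerForm_apply, hE.map_zero x hx, hE.inner_one_one hJ hx]

theorem dualBivector_kahlerForm (hJ : IsKahler J) (x : M) :
    dualBivector (kahlerForm J) x =
      !![0, (kahlerForm J x (basis x 0) (basis x 1))⁻¹;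
        -(kahlerForm J x (basis x 0) (basis x 1))⁻¹, 0] := by
  have h : mat (fun u v ↦ kahlerForm J x u v) = !![0, kahlerForm J x (basis x 0) (basis x 1);
      -kahlerForm J x (basis x 0) (basis x 1), 0] := by
    ext i j
    fin_cases i <;> fin_cases j <;>
      simp [mat, hJ.kahlerForm_self, hJ.kahlerForm_swap x (basis x 1) (basis x 0)]
  rw [dualBivector, h, Matrix.inv_def, Matrix.det_fin_two, Matrix.adjugate_fin_two]
  generalize kahlerForm J x (basis x 0) (basis x 1) = t
  ext i j
  fin_cases i <;> fin_cases j <;> simp [Ring.inverse_eq_inv']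
  -- When `t = 0` both sides are zero by the convention `0⁻¹ = 0`, so nondegeneracy is not needed
  -- yet.
  all_goals by_cases ht : t = 0 <;> simp [ht]

theorem IsAdaptedFrame.kahlerForm_basis {E : Fin 2 → Π x : M, 𝕋 x} {s : Set M}
    (hE : IsAdaptedFrame J E s) (hJ : IsKahler J) {x : M} (hx : x ∈ s) (u v : 𝕋 x) :
    kahlerForm J x u v = inner ℝ u (E 0 x) * inner ℝ v (E 1 x)
      - inner ℝ u (E 1 x) * inner ℝ v (E 0 x) := by
  rw [hE.bilin_expand hJ hx (isBilinearMap_kahlerForm J x), hJ.kahlerForm_self, hJ.kahlerForm_self,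
    hJ.kahlerForm_swap x (E 1 x), hE.kahlerForm_zero_one hJ hx]
  ring

/-- Otherwise `Ω(b₀, ·)` vanishes identically; testing it on `J b₀` gives `|J b₀|² = 0`, and `J² =
-1` then forces `b₀ = 0`. -/
theorem kahlerForm_basis_ne_zero (hJ : IsKahler J) (x : M) :
    kahlerForm J x (basis x 0) (basis x 1) ≠ 0 := by
  intro h
  have h0 (v : 𝕋 x) : kahlerForm J x (basis x 0) v = 0 := by
    rw [← (basis x).sum_repr v, Fin.sum_univ_two, map_add, map_smul, map_smul, h,
      hJ.kahlerForm_self]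
    simp
  have h1 := h0 (J x (basis x 0))
  rw [kahlerForm_apply, inner_self_eq_zero] at h1
  have h2 := hJ.sq x (basis x 0)
  rw [h1, map_zero, eq_comm, neg_eq_zero] at h2
  exact (basis x).ne_zero 0 h2

/-- The contraction of a bilinear form with the dual bivector in an adapted frame. -/
theorem IsAdaptedFrame.sum_dualBivector {E : Fin 2 → Π x : M, 𝕋 x} {s : Set M}
    (hE : IsAdaptedFrame J E s) (hJ : IsKahler J) {x : M} (hx : x ∈ s) {f : 𝕋 x → 𝕋 x → ℝ}
    (hf : IsBilinearMap ℝ f) :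
    ∑ p, ∑ q, dualBivector (kahlerForm J) x p q * f (basis x q) (basis x p) =
      f (E 1 x) (E 0 x) - f (E 0 x) (E 1 x) := by
  have hω := kahlerForm_basis_ne_zero hJ x
  rw [dualBivector_kahlerForm hJ]
  simp only [Fin.sum_univ_two, Matrix.of_apply, Matrix.cons_val', Matrix.cons_val_zero,
    Matrix.cons_val_one, Matrix.cons_val_fin_one]
  -- The skew part of `f` on a pair of vectors scales by the determinant of the pair in the frame.
  -- That determinant is the value of the Kähler form on the pair, which is what the bivector
  -- divides by.
  rw [hE.bilin_expand hJ hx hf (basis x 1) (basis x 0),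
    hE.bilin_expand hJ hx hf (basis x 0) (basis x 1)]
  field_simp
  rw [hE.kahlerForm_basis hJ hx]
  ring

variable [IsContMDiffRiemannianBundle (𝓡 2) ∞ (EuclideanSpace ℝ (Fin 2))
  (fun x : M ↦ TangentSpace (𝓡 2) x)]

variable {B : Π x : M, 𝕋 x → 𝕋 x → ℝ}

/-- Ricci is not given as a smooth section of a bundle; only its four frame components are known to
be differentiable. This transfers differentiability to arbitrary pairs of fields. -/
theorem IsAdaptedFrame.bilin_diffAt {E : Fin 2 → Π x : M, 𝕋 x} {s : Set M}
    (hE : IsAdaptedFrame J E s) (hJ : IsKahler J) {x : M} (hx : x ∈ s)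
    (hB : ∀ x, IsBilinearMap ℝ (B x)) (hBE : ∀ a b, FunDiffAt (fun y ↦ B y (E a y) (E b y)) x)
    {V W : Π x : M, 𝕋 x} (hV : FieldDiffAt V x) (hW : FieldDiffAt W x) :
    FunDiffAt (fun y ↦ B y (V y) (W y)) x := by
  have hv (a) := hV.inner ((hE.smooth a).diffAt x)
  have hw (a) := hW.inner ((hE.smooth a).diffAt x)
  have h := ((((hv 0).mul (hw 0)).mul (hBE 0 0)).add (((hv 0).mul (hw 1)).mul (hBE 0 1))).add
    (((hv 1).mul (hw 0)).mul (hBE 1 0)) |>.add (((hv 1).mul (hw 1)).mul (hBE 1 1))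
  refine h.congr_of_eventuallyEq (Filter.eventually_of_mem (hE.isOpen.mem_nhds hx) fun y hy ↦ ?_)
  exact hE.bilin_expand hJ hy (hB y) (V y) (W y)

/-- The covariant derivative of a two-tensor evaluated on vector fields. -/
theorem covTwoTensor_apply {E : Fin 2 → Π x : M, 𝕋 x} {s : Set M}
    (hE : IsAdaptedFrame J E s) (hJ : IsKahler J) {x : M} (hx : x ∈ s) (D : AffineConnection M)
    (hB : ∀ x, IsBilinearMap ℝ (B x)) (hBE : ∀ a b, FunDiffAt (fun y ↦ B y (E a y) (E b y)) x)
    {V W : Π x : M, 𝕋 x} (hV : FieldDiffAt V x) (hW : FieldDiffAt W x) (u : 𝕋 x) :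
    covTwoTensor D B x u (V x) (W x) = mvfderiv (𝓡 2) (fun y ↦ B y (V y) (W y)) x u
      - B x (D V x u) (W x) - B x (V x) (D W x u) := by
  have hd {Y Z : Π x : M, 𝕋 x} (hY : FieldDiffAt Y x) (hZ : FieldDiffAt Z x) :=
    hE.bilin_diffAt hJ hx hB hBE hY hZ
  -- The right-hand side is tensorial in both fields, because the derivative of a factor `f` cancels
  -- between the product rule and the Leibniz rule. Hence `V` and `W` may be exchanged for `field (V
  -- x)` and `field (W x)`.
  have key := TensorialAt.pointwise₂ (I := 𝓡 2) (F := EuclideanSpace ℝ (Fin 2))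
    (F' := EuclideanSpace ℝ (Fin 2)) (x := x)
    (Φ := fun V W : Π x : M, 𝕋 x ↦ mvfderiv (𝓡 2) (fun y ↦ B y (V y) (W y)) x u
      - B x (D V x u) (W x) - B x (V x) (D W x u))
    (fun W hW ↦ {
      smul := fun {f V} hf hV ↦ by
        have e : (fun y ↦ B y ((f • V) y) (W y)) = fun y ↦ f y * B y (V y) (W y) :=
          funext fun y ↦ (hB y).smul_left _ _ _
        rw [e, mvfderiv_fun_mul hf (hd hV hW), cov_smul_apply D hf hV]
        simp only [Pi.smul_apply', (hB x).add_left, (hB x).smul_left, smul_eq_mul,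
          add_apply, smul_apply]
        ring
      add := fun {V V'} hV hV' ↦ by
        have e : (fun y ↦ B y ((V + V') y) (W y)) =
            fun y ↦ B y (V y) (W y) + B y (V' y) (W y) :=
          funext fun y ↦ (hB y).add_left _ _ _
        rw [e, mvfderiv_fun_add (hd hV hW) (hd hV' hW), cov_add_apply D hV hV']
        simp only [Pi.add_apply, (hB x).add_left, add_apply]
        ring })
    (fun V hV ↦ {
      smul := fun {f W} hf hW ↦ by
        have e : (fun y ↦ B y (V y) ((f • W) y)) = fun y ↦ f y * B y (V y) (W y) :=
          funext fun y ↦ (hB y).smul_right _ _ _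
        rw [e, mvfderiv_fun_mul hf (hd hV hW), cov_smul_apply D hf hW]
        simp only [Pi.smul_apply', (hB x).add_right, (hB x).smul_right, smul_eq_mul,
          add_apply, smul_apply]
        ring
      add := fun {W W'} hW hW' ↦ by
        have e : (fun y ↦ B y (V y) ((W + W') y)) =
            fun y ↦ B y (V y) (W y) + B y (V y) (W' y) :=
          funext fun y ↦ (hB y).add_right _ _ _
        rw [e, mvfderiv_fun_add (hd hV hW) (hd hV hW'), cov_add_apply D hW hW']
        simp only [Pi.add_apply, (hB x).add_right, add_apply]
        ring })
    hV (fieldDiffAt_field (V x)) hW (fieldDiffAt_field (W x)) (field_self _).symm (field_self _).symm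
  refine Eq.trans ?_ key.symm
  simp only [covTwoTensor, field_self]

/-- The covariant derivative of a two-tensor is linear in its last two arguments. -/
theorem isBilinearMap_covTwoTensor {E : Fin 2 → Π x : M, 𝕋 x} {s : Set M}
    (hE : IsAdaptedFrame J E s) (hJ : IsKahler J) {x : M} (hx : x ∈ s) (D : AffineConnection M)
    (hB : ∀ x, IsBilinearMap ℝ (B x)) (hBE : ∀ a b, FunDiffAt (fun y ↦ B y (E a y) (E b y)) x)
    (u : 𝕋 x) : IsBilinearMap ℝ (covTwoTensor D B x u) := by
  have hd {Y Z : Π x : M, 𝕋 x} (hY : FieldDiffAt Y x) (hZ : FieldDiffAt Z x) :=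
    hE.bilin_diffAt hJ hx hB hBE hY hZ
  have hc {V W : Π x : M, 𝕋 x} (hV : FieldDiffAt V x) (hW : FieldDiffAt W x) :=
    covTwoTensor_apply hE hJ hx D hB hBE hV hW u
  have hf (v : 𝕋 x) : FieldDiffAt (field v) x := fieldDiffAt_field v
  refine ⟨fun v v' w ↦ ?_, fun c v w ↦ ?_, fun v w w' ↦ ?_, fun c v w ↦ ?_⟩
  · have h := hc ((hf v).add (hf v')) (hf w)
    rw [cov_add_apply D (hf v) (hf v')] at h
    simp only [Pi.add_apply, field_self, (hB _).add_left] at h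
    rw [h, mvfderiv_fun_add (hd (hf v) (hf w)) (hd (hf v') (hf w)), covTwoTensor, covTwoTensor]
    simp only [add_apply]
    ring
  · have hk := (isSmoothFun_const (M := M) c).diffAt x
    have h := hc ((hf v).smul hk) (hf w)
    rw [cov_smul_apply D hk (hf v)] at h
    simp only [Pi.smul_apply', field_self, (hB _).smul_left, mvfderiv_const, zero_apply, zero_smul,
      add_zero, smul_eq_mul] at h
    rw [h, mvfderiv_fun_mul hk (hd (hf v) (hf w)), covTwoTensor]
    simp only [add_apply, smul_apply, mvfderiv_const, smul_eq_mul, zero_apply]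
    ring
  · have h := hc (hf v) ((hf w).add (hf w'))
    rw [cov_add_apply D (hf w) (hf w')] at h
    simp only [Pi.add_apply, field_self, (hB _).add_right] at h
    rw [h, mvfderiv_fun_add (hd (hf v) (hf w)) (hd (hf v) (hf w')), covTwoTensor, covTwoTensor]
    simp only [add_apply]
    ring
  · have hk := (isSmoothFun_const (M := M) c).diffAt x
    have h := hc (hf v) ((hf w).smul hk)
    rw [cov_smul_apply D hk (hf w)] at h
    simp only [Pi.smul_apply', field_self, (hB _).smul_right, mvfderiv_const, zero_apply, zero_smul,
      add_zero, smul_eq_mul] at h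
    rw [h, mvfderiv_fun_mul hk (hd (hf v) (hf w)), covTwoTensor]
    simp only [add_apply, smul_apply, mvfderiv_const, smul_eq_mul, zero_apply]
    ring

/-- The curvature one-form in an adapted frame. -/
theorem curvatureOneForm_eq_frame [T2Space M] {D : AffineConnection M}
    (hD : CovariantDerivative.ContMDiffCovariantDerivative D ∞)
    {E : Fin 2 → Π x : M, 𝕋 x} {s : Set M}
    (hE : IsAdaptedFrame J E s) (hJ : IsKahler J) {x : M} (hx : x ∈ s)
    (hR : ∀ a b, FunDiffAt (fun y ↦ ricci D y (E a y) (E b y)) x) (v : 𝕋 x) :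
    curvatureOneForm (kahlerForm J) D x v =
      2 * (covTwoTensor D (ricci D) x (E 1 x) v (E 0 x)
        - covTwoTensor D (ricci D) x (E 0 x) v (E 1 x)) := by
  have hB := isBilinearMap_ricci hJ hD
  have hT := isBilinearMap_covTwoTensor hE hJ hx D hB hR
  rw [curvatureOneForm, hE.sum_dualBivector hJ hx (f := fun u w ↦ covTwoTensor D (ricci D) x u v w)]
  refine ⟨fun u u' w ↦ ?_, fun c u w ↦ ?_, fun u w w' ↦ (hT u).add_right v w w',
    fun c u w ↦ (hT u).smul_right c v w⟩
  · simp only [covTwoTensor, map_add, (hB x).add_left, (hB x).add_right]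
    ring
  · simp only [covTwoTensor, map_smul, (hB x).smul_left, (hB x).smul_right, smul_eq_mul]
    ring

theorem curvatureOneForm_expand [T2Space M] {D : AffineConnection M}
    (hD : CovariantDerivative.ContMDiffCovariantDerivative D ∞)
    {E : Fin 2 → Π x : M, 𝕋 x} {s : Set M}
    (hE : IsAdaptedFrame J E s) (hJ : IsKahler J) {x : M} (hx : x ∈ s)
    (hR : ∀ a b, FunDiffAt (fun y ↦ ricci D y (E a y) (E b y)) x) (v : 𝕋 x) :
    curvatureOneForm (kahlerForm J) D x v =
      inner ℝ v (E 0 x) * curvatureOneForm (kahlerForm J) D x (E 0 x)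
        + inner ℝ v (E 1 x) * curvatureOneForm (kahlerForm J) D x (E 1 x) := by
  have hT := isBilinearMap_covTwoTensor hE hJ hx D (isBilinearMap_ricci hJ hD) hR
  simp only [curvatureOneForm_eq_frame hD hE hJ hx hR]
  have h (u w : 𝕋 x) : covTwoTensor D (ricci D) x u v w =
      inner ℝ v (E 0 x) * covTwoTensor D (ricci D) x u (E 0 x) w
        + inner ℝ v (E 1 x) * covTwoTensor D (ricci D) x u (E 1 x) w := by
    conv_lhs => rw [hE.expand hJ hx v]
    rw [(hT u).add_left, (hT u).smul_left, (hT u).smul_left, smul_eq_mul, smul_eq_mul]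
  rw [h, h]
  ring

end Tensors

/-! ### The difference tensor and the deformed connection -/

section DifferenceTensor

variable {M : Type*} [TopologicalSpace M] [ChartedSpace (EuclideanSpace ℝ (Fin 2)) M]
  [RiemannianBundle (fun x : M ↦ TangentSpace (𝓡 2) x)]

theorem differenceTensor_apply (Ω : Π x : M, 𝕋 x →L[ℝ] 𝕋 x →L[ℝ] ℝ) (X : Π x : M, 𝕋 x →L[ℝ] ℝ)
    (x : M) (u v : 𝕋 x) : differenceTensor Ω X x u v = raise Ω x (cubicForm X x u v) := rfl

theorem differenceTensor_comm (Ω : Π x : M, 𝕋 x →L[ℝ] 𝕋 x →L[ℝ] ℝ) (X : Π x : M, 𝕋 x →L[ℝ] ℝ)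
    (x : M) (u v : 𝕋 x) : differenceTensor Ω X x u v = differenceTensor Ω X x v u := by
  rw [differenceTensor_apply, differenceTensor_apply]
  congr 1
  ext w
  simp only [cubicForm, real_inner_comm u v]
  ring

end DifferenceTensor

section Deformation

variable {M : Type*} [TopologicalSpace M] [ChartedSpace (EuclideanSpace ℝ (Fin 2)) M]
  [IsManifold (𝓡 2) ∞ M]

/-- An endomorphism field is smooth if it maps smooth vector fields to smooth vector fields. -/
theorem contMDiff_hom_of_apply [T2Space M] {A : Π x : M, 𝕋 x →L[ℝ] 𝕋 x}
    (hA : ∀ Y, IsSmoothField Y → IsSmoothField fun y ↦ A y (Y y)) :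
    ContMDiff (𝓡 2)
    ((𝓡 2).prod 𝓘(ℝ, EuclideanSpace ℝ (Fin 2) →L[ℝ] EuclideanSpace ℝ (Fin 2))) ∞
    (fun x ↦ TotalSpace.mk' (EuclideanSpace ℝ (Fin 2) →L[ℝ] EuclideanSpace ℝ (Fin 2))
      (E := fun x : M ↦ 𝕋 x →L[ℝ] 𝕋 x) x (A x)) := by
  intro x
  rw [contMDiffAt_hom_bundle]
  refine ⟨contMDiffAt_id, ?_⟩
  set t := trivializationAt (EuclideanSpace ℝ (Fin 2)) (TangentSpace (𝓡 2) : M → Type _) x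
  set φ : M → EuclideanSpace ℝ (Fin 2) →L[ℝ] EuclideanSpace ℝ (Fin 2) := fun y ↦
    ContinuousLinearMap.inCoordinates (EuclideanSpace ℝ (Fin 2)) (fun x : M ↦ 𝕋 x)
      (EuclideanSpace ℝ (Fin 2)) (fun x : M ↦ 𝕋 x) x y x y (A y) with hφ
  have hx : x ∈ t.baseSet := FiberBundle.mem_baseSet_trivializationAt' x
  -- Column by column: `φ y v` is the coordinate expression of `A` applied to a field that is
  -- constant in the trivialization. `hsum` reassembles `φ` from its columns.
  have h (v : EuclideanSpace ℝ (Fin 2)) :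
      ContMDiffAt (𝓡 2) 𝓘(ℝ, EuclideanSpace ℝ (Fin 2)) ∞ (fun y ↦ φ y v) x := by
    obtain ⟨Z, hZ, hZv, -⟩ := exists_isSmoothField_eq_field (t.symm x v)
    refine ((contMDiffAt_section _).1 (hA Z hZ x)).congr_of_eventuallyEq ?_
    filter_upwards [hZv, t.open_baseSet.mem_nhds hx] with y hy hyt
    have hfield : field (t.symm x v) y = t.symm y v := by
      simp only [field, FiberBundle.extend]
      rw [t.apply_mk_symm hx]
    simp only [hφ, ContinuousLinearMap.inCoordinates, ContinuousLinearMap.comp_apply,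
      hy, hfield]
    rw [Trivialization.symmL_apply _ hyt]
    exact Trivialization.continuousLinearMapAt_apply_of_mem (R := ℝ) t hyt (A y (t.symm y v))
  have hsum : φ = fun y ↦ ∑ a, ContinuousLinearMap.smulRightL ℝ (EuclideanSpace ℝ (Fin 2))
      (EuclideanSpace ℝ (Fin 2)) (EuclideanSpace.proj a)
      (φ y (EuclideanSpace.basisFun (Fin 2) ℝ a)) := by
    ext1 y
    refine ContinuousLinearMap.coe_injective
      ((EuclideanSpace.basisFun (Fin 2) ℝ).toBasis.ext fun a ↦ ?_)
    fin_cases a <;> simp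
  change ContMDiffAt (𝓡 2) 𝓘(ℝ, EuclideanSpace ℝ (Fin 2) →L[ℝ] EuclideanSpace ℝ (Fin 2)) ∞ φ x
  rw [hsum]
  exact ContMDiffAt.sum fun a _ ↦ (ContinuousLinearMap.contMDiff _).contMDiffAt.comp x (h _)

/-- Smoothness of a one-form. -/
abbrev IsSmoothForm (X : Π x : M, 𝕋 x →L[ℝ] ℝ) : Prop :=
  ContMDiff (𝓡 2) ((𝓡 2).prod 𝓘(ℝ, EuclideanSpace ℝ (Fin 2) →L[ℝ] ℝ)) ∞
    (fun x ↦ TotalSpace.mk' (EuclideanSpace ℝ (Fin 2) →L[ℝ] ℝ)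
      (E := fun x : M ↦ 𝕋 x →L[ℝ] ℝ) x (X x))

theorem IsSmoothForm.apply {X : Π x : M, 𝕋 x →L[ℝ] ℝ}
    (hX : IsSmoothForm X) {Y : Π x : M, 𝕋 x} (hY : IsSmoothField Y) :
    IsSmoothFun fun y ↦ X y (Y y) := by
  have h : ContMDiff (𝓡 2) ((𝓡 2).prod 𝓘(ℝ, ℝ)) ∞ fun y ↦
      TotalSpace.mk' ℝ (E := Bundle.Trivial M ℝ) y (X y (Y y)) :=
    ContMDiff.clm_bundle_apply (F₁ := EuclideanSpace ℝ (Fin 2)) (F₂ := ℝ) hX hY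
  exact fun y ↦ (contMDiffAt_section _).1 (h y)

variable [RiemannianBundle (fun x : M ↦ TangentSpace (𝓡 2) x)]
  {J : Π x : M, 𝕋 x →L[ℝ] 𝕋 x}

/-- Passing from the coordinate basis to the frame multiplies `α(b₁) b₀ - α(b₀) b₁` by the
determinant of the change of basis, and this is the value of `Ω` whose inverse enters the bivector.
-/
theorem IsAdaptedFrame.raise_eq {E : Fin 2 → Π x : M, 𝕋 x} {s : Set M}
    (hE : IsAdaptedFrame J E s) (hJ : IsKahler J) {x : M} (hx : x ∈ s) {α : 𝕋 x → ℝ}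
    (hα : IsLinearMap ℝ α) :
    raise (kahlerForm J) x α = α (E 1 x) • E 0 x - α (E 0 x) • E 1 x := by
  have ht := kahlerForm_basis_ne_zero hJ x
  have hb (p : Fin 2) : α (basis x p) =
      inner ℝ (basis x p) (E 0 x) * α (E 0 x) + inner ℝ (basis x p) (E 1 x) * α (E 1 x) := by
    conv_lhs => rw [hE.expand hJ hx (basis x p)]
    rw [hα.map_add, hα.map_smul, hα.map_smul, smul_eq_mul, smul_eq_mul]
  have h1 : raise (kahlerForm J) x α = (kahlerForm J x (basis x 0) (basis x 1))⁻¹ •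
      (α (basis x 1) • basis x 0 - α (basis x 0) • basis x 1) := by
    rw [raise, dualBivector_kahlerForm hJ]
    simp only [Fin.sum_univ_two, Matrix.of_apply, Matrix.cons_val', Matrix.cons_val_zero,
      Matrix.cons_val_one, Matrix.cons_val_fin_one]
    module
  have key {b₀ b₁ e₀ e₁ : 𝕋 x} {p q r s : ℝ} (h₀ : b₀ = p • e₀ + q • e₁)
      (h₁ : b₁ = r • e₀ + s • e₁) (a₀ a₁ : ℝ) :
      (r * a₀ + s * a₁) • b₀ - (p * a₀ + q * a₁) • b₁ =
        (p * s - q * r) • (a₁ • e₀ - a₀ • e₁) := by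
    subst h₀ h₁
    module
  rw [h1, inv_smul_eq_iff₀ ht, hb, hb, hE.kahlerForm_basis hJ hx]
  exact key (hE.expand hJ hx _) (hE.expand hJ hx _) _ _

theorem deformedConnection_apply (Ω : Π x : M, 𝕋 x →L[ℝ] 𝕋 x →L[ℝ] ℝ) (D : AffineConnection M)
    (X : Π x : M, 𝕋 x →L[ℝ] ℝ) (Y : Π x : M, 𝕋 x) (x : M) (u : 𝕋 x) :
    deformedConnection Ω D X Y x u = D Y x u + differenceTensor Ω X x (Y x) u := rfl

theorem torsion_deformedConnection {Ω : Π x : M, 𝕋 x →L[ℝ] 𝕋 x →L[ℝ] ℝ} {D : AffineConnection M}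
    {X : Π x : M, 𝕋 x →L[ℝ] ℝ}
    (hD : D.torsion = 0) : (deformedConnection Ω D X).torsion = 0 := by
  rw [CovariantDerivative.torsion_eq_zero_iff] at hD ⊢
  intro Y Z x hY hZ
  rw [deformedConnection_apply, deformedConnection_apply, differenceTensor_comm, ← hD hY hZ]
  abel

theorem IsAdaptedFrame.differenceTensor_eq {E : Fin 2 → Π x : M, 𝕋 x} {s : Set M}
    (hE : IsAdaptedFrame J E s) (hJ : IsKahler J) {x : M} (hx : x ∈ s) (X : Π x : M, 𝕋 x →L[ℝ] ℝ)
    (u v : 𝕋 x) : differenceTensor (kahlerForm J) X x u v =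
      cubicForm X x u v (E 1 x) • E 0 x - cubicForm X x u v (E 0 x) • E 1 x := by
  rw [differenceTensor_apply, hE.raise_eq hJ hx]
  refine ⟨fun w w' ↦ ?_, fun c w ↦ ?_⟩
  · simp only [cubicForm, map_add, inner_add_right]
    ring
  · simp only [cubicForm, map_smul, real_inner_smul_right, smul_eq_mul]
    ring

variable [IsContMDiffRiemannianBundle (𝓡 2) ∞ (EuclideanSpace ℝ (Fin 2))
  (fun x : M ↦ TangentSpace (𝓡 2) x)] {X : Π x : M, 𝕋 x →L[ℝ] ℝ}

theorem IsSmoothForm.cubicForm (hX : IsSmoothForm X) {Y Z W : Π x : M, 𝕋 x}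
    (hY : IsSmoothField Y) (hZ : IsSmoothField Z) (hW : IsSmoothField W) :
    IsSmoothFun fun y ↦ cubicForm X y (Y y) (Z y) (W y) :=
  (((hX.apply hY).mul (hZ.inner hW)).add ((hX.apply hZ).mul (hY.inner hW))).add
    ((hX.apply hW).mul (hY.inner hZ))

theorem IsSmoothForm.differenceTensor [T2Space M] (hX : IsSmoothForm X) (hJ : IsKahler J)
    {Y Z : Π x : M, 𝕋 x} (hY : IsSmoothField Y) (hZ : IsSmoothField Z) :
    IsSmoothField fun y ↦ differenceTensor (kahlerForm J) X y (Y y) (Z y) := by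
  intro x
  obtain ⟨E, s, hxs, hE⟩ := exists_isAdaptedFrame hJ x
  have h := ((hE.smooth 0).smul (hX.cubicForm hY hZ (hE.smooth 1))).sub
    ((hE.smooth 1).smul (hX.cubicForm hY hZ (hE.smooth 0)))
  refine (h x).congr_of_eventuallyEq (Filter.eventually_of_mem (hE.isOpen.mem_nhds hxs)
    fun y hy ↦ ?_)
  simp only [hE.differenceTensor_eq hJ hy]
  rfl

theorem contMDiffCovariantDerivative_deformedConnection [T2Space M] {D : AffineConnection M}
    (hD : CovariantDerivative.ContMDiffCovariantDerivative D ∞) (hJ : IsKahler J)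
    (hX : IsSmoothForm X) :
    CovariantDerivative.ContMDiffCovariantDerivative
      (deformedConnection (kahlerForm J) D X) ∞ := by
  refine ⟨⟨fun {σ} hσ ↦ ?_⟩⟩
  have hs : IsSmoothField σ := by simpa [IsSmoothField] using contMDiffOn_univ.1 hσ
  rw [contMDiffOn_univ]
  refine contMDiff_hom_of_apply fun Y hY ↦ ?_
  exact (hs.cov hD hY).add (hX.differenceTensor hJ hs hY)

/-- The contraction of the difference tensor with the Kähler form is the cubic form. -/
theorem kahlerForm_differenceTensor [T2Space M] (hJ : IsKahler J) (x : M) (u v w : 𝕋 x) :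
    kahlerForm J x (differenceTensor (kahlerForm J) X x u v) w = cubicForm X x u v w := by
  obtain ⟨E, s, hxs, hE⟩ := exists_isAdaptedFrame hJ x
  rw [hE.differenceTensor_eq hJ hxs, hE.kahlerForm_basis hJ hxs]
  simp only [inner_sub_left, real_inner_smul_left, hE.inner_zero_zero x hxs,
    hE.inner_zero_one hJ hxs, hE.inner_one_zero hJ hxs, hE.inner_one_one hJ hxs]
  have h : cubicForm X x u v w = inner ℝ w (E 0 x) * cubicForm X x u v (E 0 x) +
      inner ℝ w (E 1 x) * cubicForm X x u v (E 1 x) := by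
    conv_lhs => rw [hE.expand hJ hxs w]
    simp only [cubicForm, map_add, inner_add_right, map_smul, real_inner_smul_right, smul_eq_mul]
    ring
  rw [h]
  ring

end Deformation

/-! ### Moving-frame calculus for the Levi-Civita connection -/

section FrameCalculus

variable {M : Type*} [TopologicalSpace M] [ChartedSpace (EuclideanSpace ℝ (Fin 2)) M]

theorem mvfderiv_eq_zero_of_eventually_const {f : M → ℝ} {x : M} {c : ℝ}
    (h : ∀ᶠ y in 𝓝 x, f y = c) (u : 𝕋 x) : mvfderiv (𝓡 2) f x u = 0 := by
  have h' : f =ᶠ[𝓝 x] fun _ ↦ c := h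
  rw [mvfderiv, h'.mfderiv_eq, mfderiv_const]
  rfl

/-- The derivative of a function along a vector field. -/
def along (Y : Π x : M, 𝕋 x) (f : M → ℝ) (y : M) : ℝ :=
  mvfderiv (𝓡 2) f y (Y y)

theorem along_congr {Y : Π x : M, 𝕋 x} {f g : M → ℝ} {x : M} (h : ∀ᶠ y in 𝓝 x, f y = g y) :
    along Y f x = along Y g x := by
  have h' : f =ᶠ[𝓝 x] g := h
  rw [along, along, mvfderiv, mvfderiv, h'.mfderiv_eq, h.self_of_nhds]

theorem along_const (Y : Π x : M, 𝕋 x) (c : ℝ) (x : M) : along Y (fun _ ↦ c) x = 0 := by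
  rw [along, mvfderiv_const, zero_apply]

theorem along_add {Y : Π x : M, 𝕋 x} {f g : M → ℝ} {x : M} (hf : FunDiffAt f x)
    (hg : FunDiffAt g x) : along Y (fun y ↦ f y + g y) x = along Y f x + along Y g x := by
  rw [along, mvfderiv_fun_add hf hg]
  rfl

theorem along_sub {Y : Π x : M, 𝕋 x} {f g : M → ℝ} {x : M} (hf : FunDiffAt f x)
    (hg : FunDiffAt g x) : along Y (fun y ↦ f y - g y) x = along Y f x - along Y g x := by
  rw [along, mvfderiv_fun_sub hf hg]
  rfl

theorem along_mul {Y : Π x : M, 𝕋 x} {f g : M → ℝ} {x : M} (hf : FunDiffAt f x)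
    (hg : FunDiffAt g x) :
    along Y (fun y ↦ f y * g y) x = f x * along Y g x + g x * along Y f x := by
  rw [along, mvfderiv_fun_mul hf hg]
  rfl

theorem along_const_mul {Y : Π x : M, 𝕋 x} {f : M → ℝ} {x : M} (c : ℝ) (hf : FunDiffAt f x) :
    along Y (fun y ↦ c * f y) x = c * along Y f x := by
  rw [along_mul ((isSmoothFun_const c).diffAt x) hf, along_const, mul_zero, add_zero]

/-- The differential of a quadratic expression in smooth functions. -/
theorem along_quadratic {Y : Π x : M, 𝕋 x} {k l f g : M → ℝ} {x : M} (hk : FunDiffAt k x)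
    (hl : FunDiffAt l x) (hf : FunDiffAt f x) (hg : FunDiffAt g x) (c p q r : ℝ) :
    along Y (fun y ↦ k y + c * l y + p * (f y * f y) + q * (g y * g y) + r * (f y * g y)) x =
      along Y k x + c * along Y l x + 2 * p * f x * along Y f x + 2 * q * g x * along Y g x
        + r * (f x * along Y g x + g x * along Y f x) := by
  have hc (c : ℝ) {h : M → ℝ} (hh : FunDiffAt h x) : FunDiffAt (fun y ↦ c * h y) x :=
    ((isSmoothFun_const c).diffAt x).mul hh
  have hff : FunDiffAt (fun y ↦ f y * f y) x := hf.mul hf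
  have hgg : FunDiffAt (fun y ↦ g y * g y) x := hg.mul hg
  have hfg : FunDiffAt (fun y ↦ f y * g y) x := hf.mul hg
  have h1 : FunDiffAt (fun y ↦ k y + c * l y) x := hk.add (hc c hl)
  have h2 : FunDiffAt (fun y ↦ k y + c * l y + p * (f y * f y)) x := h1.add (hc p hff)
  have h3 : FunDiffAt (fun y ↦ k y + c * l y + p * (f y * f y) + q * (g y * g y)) x :=
    h2.add (hc q hgg)
  rw [along_add h3 (hc r hfg), along_add h2 (hc q hgg),
    along_add h1 (hc p hff), along_add hk (hc c hl), along_const_mul c hl,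
    along_const_mul p hff, along_const_mul q hgg, along_const_mul r hfg,
    along_mul hf hf, along_mul hg hg, along_mul hf hg]
  ring

variable [IsManifold (𝓡 2) ∞ M]

theorem IsSmoothFun.along {Y : Π x : M, 𝕋 x} {f : M → ℝ} (hf : IsSmoothFun f)
    (hY : IsSmoothField Y) : IsSmoothFun (along Y f) :=
  hf.derivAlong hY

/-- The covariant derivative of a one-form evaluated on a vector field. -/
theorem covOneForm_apply {X : Π x : M, 𝕋 x →L[ℝ] ℝ} (hX : IsSmoothForm X) (D : AffineConnection M)
    {V : Π x : M, 𝕋 x} {x : M} (hV : FieldDiffAt V x) (u : 𝕋 x) :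
    covOneForm D (fun y w ↦ X y w) x u (V x) =
      mvfderiv (𝓡 2) (fun y ↦ X y (V y)) x u - X x (D V x u) := by
  have hd {Y : Π x : M, 𝕋 x} (hY : FieldDiffAt Y x) : FunDiffAt (fun y ↦ X y (Y y)) x := by
    have h : MDifferentiableAt (𝓡 2) ((𝓡 2).prod 𝓘(ℝ, ℝ)) (fun y ↦
        TotalSpace.mk' ℝ (E := Bundle.Trivial M ℝ) y (X y (Y y))) x :=
      MDifferentiableAt.clm_bundle_apply (F₁ := EuclideanSpace ℝ (Fin 2)) (F₂ := ℝ)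
        (hX.mdifferentiableAt (by simp)) hY
    exact (mdifferentiableAt_section _ _).1 h
  have key := TensorialAt.pointwise (I := 𝓡 2) (F := EuclideanSpace ℝ (Fin 2)) (x := x)
    (Φ := fun V : Π x : M, 𝕋 x ↦ mvfderiv (𝓡 2) (fun y ↦ X y (V y)) x u - X x (D V x u))
    { smul := fun {f V} hf hV ↦ by
        have e : (fun y ↦ X y ((f • V) y)) = fun y ↦ f y * X y (V y) :=
          funext fun y ↦ by simp
        rw [e, mvfderiv_fun_mul hf (hd hV), cov_smul_apply D hf hV]
        simp only [map_add, map_smul, smul_eq_mul, add_apply, smul_apply]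
        ring
      add := fun {V V'} hV hV' ↦ by
        have e : (fun y ↦ X y ((V + V') y)) = fun y ↦ X y (V y) + X y (V' y) :=
          funext fun y ↦ by simp
        rw [e, mvfderiv_fun_add (hd hV) (hd hV'), cov_add_apply D hV hV']
        simp only [map_add, add_apply]
        ring } hV (fieldDiffAt_field (V x)) (field_self _).symm
  exact key.symm

variable [RiemannianBundle (fun x : M ↦ TangentSpace (𝓡 2) x)] {J : Π x : M, 𝕋 x →L[ℝ] 𝕋 x}
  {E : Fin 2 → Π x : M, 𝕋 x} {U : Set M}

/-- The contraction of a bilinear form with the inverse metric in an adapted frame. -/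
theorem IsAdaptedFrame.sum_inverseMetric (hE : IsAdaptedFrame J E U) (hJ : IsKahler J) {x : M}
    (hx : x ∈ U) {f : 𝕋 x → 𝕋 x → ℝ} (hf : IsBilinearMap ℝ f) :
    ∑ i, ∑ j, inverseMetric x i j * f (basis x i) (basis x j) =
      f (E 0 x) (E 0 x) + f (E 1 x) (E 1 x) := by
  have ht := kahlerForm_basis_ne_zero hJ x
  rw [hE.kahlerForm_basis hJ hx] at ht
  have hg (u v : 𝕋 x) : inner ℝ u v = inner ℝ u (E 0 x) * inner ℝ v (E 0 x)
      + inner ℝ u (E 1 x) * inner ℝ v (E 1 x) := by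
    conv_lhs => rw [hE.expand hJ hx v]
    rw [inner_add_right, real_inner_smul_right, real_inner_smul_right]
    ring
  rw [inverseMetric, Matrix.inv_def, Matrix.det_fin_two, Matrix.adjugate_fin_two,
    Ring.inverse_eq_inv']
  simp only [Fin.sum_univ_two, Matrix.smul_apply, Matrix.of_apply, Matrix.cons_val',
    Matrix.cons_val_zero, Matrix.cons_val_one, Matrix.cons_val_fin_one, mat, smul_eq_mul]
  simp only [hE.bilin_expand hJ hx hf (basis x _) (basis x _)]
  rw [hg (basis x 0) (basis x 0), hg (basis x 0) (basis x 1), hg (basis x 1) (basis x 0),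
    hg (basis x 1) (basis x 1)]
  generalize inner ℝ (basis x 0) (E 0 x) = p at *
  generalize inner ℝ (basis x 0) (E 1 x) = q at *
  generalize inner ℝ (basis x 1) (E 0 x) = r at *
  generalize inner ℝ (basis x 1) (E 1 x) = s at *
  -- Lagrange's identity: the Gram determinant is the square of the frame determinant, which is
  -- nonzero since it is a value of the Kähler form.
  have hdet : (p * p + q * q) * (r * r + s * s) - (p * r + q * s) * (r * p + s * q) =
      (p * s - q * r) ^ 2 := by ring
  rw [hdet]
  have h2 : p * s - q * r ≠ 0 := ht
  field_simp
  ring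

variable [IsContMDiffRiemannianBundle (𝓡 2) ∞ (EuclideanSpace ℝ (Fin 2))
  (fun x : M ↦ TangentSpace (𝓡 2) x)] {D : AffineConnection M}

theorem IsLeviCivita.inner_deriv (hD : IsLeviCivita D) {V W : Π x : M, 𝕋 x} {x : M}
    (hV : FieldDiffAt V x) (hW : FieldDiffAt W x) (u : 𝕋 x) :
    mvfderiv (𝓡 2) (fun y ↦ inner ℝ (V y) (W y)) x u =
      inner ℝ (D V x u) (W x) + inner ℝ (V x) (D W x u) := by
  have : IsContMDiffRiemannianBundle (𝓡 2) 1 (EuclideanSpace ℝ (Fin 2))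
      (fun x : M ↦ TangentSpace (𝓡 2) x) :=
    IsContMDiffRiemannianBundle.of_le (n := ∞) (by simp)
  have h := CovariantDerivative.IsMetricCompatible.mvfderiv_inner_eq hD.metric (field u) hV hW
  simpa only [field_self] using h

/-- The components `⟨D_{E a} (E 0), E 1⟩` of the connection form of an orthonormal frame. -/
def connForm (D : AffineConnection M) (E : Fin 2 → Π x : M, 𝕋 x) (a : Fin 2) (y : M) : ℝ :=
  inner ℝ (D (E 0) y (E a y)) (E 1 y)

theorem IsAdaptedFrame.isSmoothFun_connForm (hE : IsAdaptedFrame J E U) (hD : IsLeviCivita D)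
    (a : Fin 2) : IsSmoothFun (connForm D E a) :=
  ((hE.smooth 0).cov hD.smooth (hE.smooth a)).inner (hE.smooth 1)

namespace IsAdaptedFrame

theorem cov_zero (hE : IsAdaptedFrame J E U) (hJ : IsKahler J) (hD : IsLeviCivita D) {y : M}
    (hy : y ∈ U) (u : 𝕋 y) : D (E 0) y u = inner ℝ (D (E 0) y u) (E 1 y) • E 1 y := by
  have h := hD.inner_deriv ((hE.smooth 0).diffAt y) ((hE.smooth 0).diffAt y) u
  rw [mvfderiv_eq_zero_of_eventually_const
    (Filter.eventually_of_mem (hE.isOpen.mem_nhds hy) hE.inner_zero_zero),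
    real_inner_comm (D (E 0) y u)] at h
  have h0 : inner ℝ (D (E 0) y u) (E 0 y) = 0 := by linarith
  conv_lhs => rw [hE.expand hJ hy (D (E 0) y u), h0]
  rw [zero_smul, zero_add]

/-- Differentiating `⟨E 1, E 1⟩ = 1` removes the component along `E 1`, and differentiating `⟨E 0, E
1⟩ = 0` makes the other one minus the connection form. One form thus encodes the whole connection.
-/
theorem cov_one (hE : IsAdaptedFrame J E U) (hJ : IsKahler J) (hD : IsLeviCivita D) {y : M}
    (hy : y ∈ U) (u : 𝕋 y) : D (E 1) y u = -inner ℝ (D (E 0) y u) (E 1 y) • E 0 y := by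
  have h := hD.inner_deriv ((hE.smooth 1).diffAt y) ((hE.smooth 1).diffAt y) u
  rw [mvfderiv_eq_zero_of_eventually_const
    (Filter.eventually_of_mem (hE.isOpen.mem_nhds hy) fun z hz ↦ hE.inner_one_one hJ hz),
    real_inner_comm (D (E 1) y u)] at h
  have h' := hD.inner_deriv ((hE.smooth 0).diffAt y) ((hE.smooth 1).diffAt y) u
  rw [mvfderiv_eq_zero_of_eventually_const
    (Filter.eventually_of_mem (hE.isOpen.mem_nhds hy) fun z hz ↦ hE.inner_zero_one hJ hz),
    real_inner_comm (D (E 1) y u)] at h'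
  have h1 : inner ℝ (D (E 1) y u) (E 1 y) = 0 := by linarith
  conv_lhs => rw [hE.expand hJ hy (D (E 1) y u), h1]
  rw [zero_smul, add_zero]
  congr 1
  linarith

theorem cov_zero_frame (hE : IsAdaptedFrame J E U) (hJ : IsKahler J) (hD : IsLeviCivita D) {y : M}
    (hy : y ∈ U) (a : Fin 2) : D (E 0) y (E a y) = connForm D E a y • E 1 y :=
  hE.cov_zero hJ hD hy _

theorem cov_one_frame (hE : IsAdaptedFrame J E U) (hJ : IsKahler J) (hD : IsLeviCivita D) {y : M}
    (hy : y ∈ U) (a : Fin 2) : D (E 1) y (E a y) = -connForm D E a y • E 0 y :=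
  hE.cov_one hJ hD hy _

theorem mlieBracket_eq (hE : IsAdaptedFrame J E U) (hJ : IsKahler J) (hD : IsLeviCivita D) {y : M}
    (hy : y ∈ U) : mlieBracket (𝓡 2) (E 0) (E 1) y =
      -connForm D E 0 y • E 0 y - connForm D E 1 y • E 1 y := by
  have h := (CovariantDerivative.torsion_eq_zero_iff D).1 hD.torsion_eq_zero
    ((hE.smooth 0).diffAt y) ((hE.smooth 1).diffAt y)
  rw [← h, hE.cov_zero_frame hJ hD hy, hE.cov_one_frame hJ hD hy]

/-- The commutator of the derivations along an adapted frame. -/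
theorem along_comm [T2Space M] (hE : IsAdaptedFrame J E U) (hJ : IsKahler J) (hD : IsLeviCivita D)
    {y : M} (hy : y ∈ U) {f : M → ℝ} (hf : IsSmoothFun f) :
    along (E 0) (along (E 1) f) y - along (E 1) (along (E 0) f) y =
      -connForm D E 0 y * along (E 0) f y - connForm D E 1 y * along (E 1) f y := by
  have h := mvfderiv_mlieBracket hf (hE.smooth 0) (hE.smooth 1) y
  rw [hE.mlieBracket_eq hJ hD hy, map_sub, map_smul, map_smul] at h
  exact h.symm

end IsAdaptedFrame

end FrameCalculus

/-! ### Curvature and Ricci tensor in a frame -/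

section FrameCurvature

variable {M : Type*} [TopologicalSpace M] [ChartedSpace (EuclideanSpace ℝ (Fin 2)) M]
  [IsManifold (𝓡 2) ∞ M]

theorem isBilinearMap_covOneForm [T2Space M] {X : Π x : M, 𝕋 x →L[ℝ] ℝ}
    (hX : IsSmoothForm X) (D : AffineConnection M) (x : M) :
    IsBilinearMap ℝ (covOneForm D (fun y w ↦ X y w) x) := by
  have hf (v : 𝕋 x) : FieldDiffAt (field v) x := fieldDiffAt_field v
  have hd (v : 𝕋 x) : FunDiffAt (fun y ↦ X y (field v y)) x := by
    obtain ⟨Z, hZ, hZv, -⟩ := exists_isSmoothField_eq_field v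
    exact ((hX.apply hZ).diffAt x).congr_of_eventuallyEq
      (hZv.mono fun y hy ↦ by simp only [hy])
  refine ⟨fun u u' v ↦ ?_, fun c u v ↦ ?_, fun u v v' ↦ ?_, fun c u v ↦ ?_⟩
  · simp only [covOneForm, map_add]
    ring
  · simp only [covOneForm, map_smul, smul_eq_mul]
    ring
  · have h := covOneForm_apply hX D ((hf v).add (hf v')) u
    rw [cov_add_apply D (hf v) (hf v')] at h
    simp only [Pi.add_apply, field_self, map_add] at h
    rw [h, mvfderiv_fun_add (hd v) (hd v'), covOneForm, covOneForm]
    simp only [add_apply]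
    ring
  · have hk := (isSmoothFun_const (M := M) c).diffAt x
    have h := covOneForm_apply hX D ((hf v).smul hk) u
    rw [cov_smul_apply D hk (hf v)] at h
    simp only [Pi.smul_apply', field_self, mvfderiv_const, zero_apply, zero_smul,
      add_zero, smul_eq_mul, map_smul] at h
    rw [h, mvfderiv_fun_mul hk (hd v), covOneForm]
    simp only [add_apply, smul_apply, mvfderiv_const, smul_eq_mul, zero_apply]
    ring

variable [RiemannianBundle (fun x : M ↦ TangentSpace (𝓡 2) x)] {J : Π x : M, 𝕋 x →L[ℝ] 𝕋 x}
  {E : Fin 2 → Π x : M, 𝕋 x} {U : Set M} {D : AffineConnection M} {X : Π x : M, 𝕋 x →L[ℝ] ℝ}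

/-- The first components, in an adapted frame, of the covariant derivatives of the frame with
respect to the deformed connection. -/
def coeffZero (D : AffineConnection M) (X : Π x : M, 𝕋 x →L[ℝ] ℝ) (E : Fin 2 → Π x : M, 𝕋 x)
    (a b : Fin 2) : M → ℝ :=
  !![fun y ↦ X y (E 1 y), fun y ↦ X y (E 0 y) - connForm D E 0 y;
    fun y ↦ X y (E 0 y), fun y ↦ 3 * X y (E 1 y) - connForm D E 1 y] a b

/-- The second components of the covariant derivatives of the frame. -/
def coeffOne (D : AffineConnection M) (X : Π x : M, 𝕋 x →L[ℝ] ℝ) (E : Fin 2 → Π x : M, 𝕋 x)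
    (a b : Fin 2) : M → ℝ :=
  -- Negation is written as `-1 * _` so that `along_const_mul` differentiates these entries as well.
  !![fun y ↦ connForm D E 0 y - 3 * X y (E 0 y), fun y ↦ -1 * X y (E 1 y);
    fun y ↦ connForm D E 1 y - X y (E 1 y), fun y ↦ -1 * X y (E 0 y)] a b

/-- The component `X_{00}` of the covariant derivative of a harmonic one-form. -/
def derivDiag (D : AffineConnection M) (X : Π x : M, 𝕋 x →L[ℝ] ℝ) (E : Fin 2 → Π x : M, 𝕋 x)
    (y : M) : ℝ :=
  along (E 0) (fun z ↦ X z (E 0 z)) y - connForm D E 0 y * X y (E 1 y)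

/-- The component `X_{01}` of the covariant derivative of a harmonic one-form. -/
def derivOff (D : AffineConnection M) (X : Π x : M, 𝕋 x →L[ℝ] ℝ) (E : Fin 2 → Π x : M, 𝕋 x)
    (y : M) : ℝ :=
  along (E 0) (fun z ↦ X z (E 1 z)) y + connForm D E 0 y * X y (E 0 y)

/-- The Gauss curvature, computed from the connection form of an orthonormal frame. -/
def gaussCurv (D : AffineConnection M) (E : Fin 2 → Π x : M, 𝕋 x) (y : M) : ℝ :=
  -(along (E 0) (connForm D E 1) y - along (E 1) (connForm D E 0) y
    + connForm D E 0 y * connForm D E 0 y + connForm D E 1 y * connForm D E 1 y)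

namespace IsAdaptedFrame

/-- The covariant derivative of a field given by its components in a frame. -/
theorem cov_of_components (hE : IsAdaptedFrame J E U)
    (D : AffineConnection M) {y : M} (hy : y ∈ U) {V : Π x : M, 𝕋 x} {f g : M → ℝ} (hf : IsSmoothFun f)
    (hg : IsSmoothFun g) (h : ∀ z ∈ U, V z = f z • E 0 z + g z • E 1 z) (u : 𝕋 y) :
    D V y u = mvfderiv (𝓡 2) f y u • E 0 y + f y • D (E 0) y u
      + (mvfderiv (𝓡 2) g y u • E 1 y + g y • D (E 1) y u) := by
  have h0 := (hE.smooth 0).diffAt y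
  have h1 := (hE.smooth 1).diffAt y
  have hf := hf.diffAt y
  have hg := hg.diffAt y
  rw [cov_congr D (Z := f • E 0 + g • E 1) ((h0.smul hf).add (h1.smul hg))
    (Filter.eventually_of_mem (hE.isOpen.mem_nhds hy) h), cov_add_apply D (h0.smul hf) (h1.smul hg),
    cov_smul_apply D hf h0, cov_smul_apply D hg h1]
  abel

variable [IsContMDiffRiemannianBundle (𝓡 2) ∞ (EuclideanSpace ℝ (Fin 2))
  (fun x : M ↦ TangentSpace (𝓡 2) x)]

theorem deformedConnection_frame (hE : IsAdaptedFrame J E U) (hJ : IsKahler J)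
    (hD : IsLeviCivita D) (X : Π x : M, 𝕋 x →L[ℝ] ℝ) {y : M} (hy : y ∈ U) (a b : Fin 2) :
    deformedConnection (kahlerForm J) D X (E b) y (E a y) =
      coeffZero D X E a b y • E 0 y + coeffOne D X E a b y • E 1 y := by
  rw [deformedConnection_apply, hE.differenceTensor_eq hJ hy]
  fin_cases a <;> fin_cases b <;>
  simp [-inner_self_eq_norm_sq_to_K, cubicForm, coeffZero, coeffOne, hE.cov_zero_frame hJ hD hy, hE.cov_one_frame hJ hD hy,
    hE.inner_zero_zero y hy, hE.inner_zero_one hJ hy, hE.inner_one_zero hJ hy,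
    hE.inner_one_one hJ hy] <;>
  module

theorem isSmoothFun_coeff (hE : IsAdaptedFrame J E U) (hD : IsLeviCivita D) (hX : IsSmoothForm X)
    (a b : Fin 2) : IsSmoothFun (coeffZero D X E a b) ∧ IsSmoothFun (coeffOne D X E a b) := by
  have hθ := hE.isSmoothFun_connForm hD
  have hx (a : Fin 2) := hX.apply (hE.smooth a)
  have hc (c : ℝ) (a : Fin 2) : IsSmoothFun fun y ↦ c * X y (E a y) :=
    (isSmoothFun_const c).mul (hx a)
  fin_cases a <;> fin_cases b <;> constructor
  exacts [hx 1, (hθ 0).sub (hc 3 0), (hx 0).sub (hθ 0), hc (-1) 1, hx 0, (hθ 1).sub (hx 1),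
    (hc 3 1).sub (hθ 1), hc (-1) 0]

/-- Closedness is `X_{10} = X_{01}`, which replaces a derivative along `E 1` by `derivOff`. -/
theorem along_one_zero (hE : IsAdaptedFrame J E U) (hJ : IsKahler J) (hD : IsLeviCivita D)
    (hX : IsHarmonicOneForm D X) {y : M} (hy : y ∈ U) :
    along (E 1) (fun z ↦ X z (E 0 z)) y = derivOff D X E y + connForm D E 1 y * X y (E 1 y) := by
  have h := hX.closed y (E 0 y) (E 1 y)
  rw [covOneForm_apply hX.smooth D ((hE.smooth 0).diffAt y),
    covOneForm_apply hX.smooth D ((hE.smooth 1).diffAt y), hE.cov_zero_frame hJ hD hy,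
    hE.cov_one_frame hJ hD hy, map_smul, map_smul, smul_eq_mul, smul_eq_mul] at h
  simp only [derivOff, along]
  linarith

theorem isSmoothFun_derivDiag (hE : IsAdaptedFrame J E U) (hD : IsLeviCivita D)
    (hX : IsSmoothForm X) : IsSmoothFun (derivDiag D X E) :=
  ((hX.apply (hE.smooth 0)).along (hE.smooth 0)).sub
    ((hE.isSmoothFun_connForm hD 0).mul (hX.apply (hE.smooth 1)))

theorem isSmoothFun_derivOff (hE : IsAdaptedFrame J E U) (hD : IsLeviCivita D)
    (hX : IsSmoothForm X) : IsSmoothFun (derivOff D X E) :=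
  ((hX.apply (hE.smooth 1)).along (hE.smooth 0)).add
    ((hE.isSmoothFun_connForm hD 0).mul (hX.apply (hE.smooth 0)))

theorem isSmoothFun_gaussCurv (hE : IsAdaptedFrame J E U) (hD : IsLeviCivita D) :
    IsSmoothFun (gaussCurv D E) := by
  have h := hE.isSmoothFun_connForm hD
  exact (((((h 1).along (hE.smooth 0)).sub ((h 0).along (hE.smooth 1))).add
    ((h 0).mul (h 0))).add ((h 1).mul (h 1))).neg

variable [T2Space M]

/-- The curvature in terms of the connection coefficients of a frame. -/
theorem curvature_of_components (hE : IsAdaptedFrame J E U) (hJ : IsKahler J)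
    (hD : CovariantDerivative.ContMDiffCovariantDerivative D ∞) {y : M} (hy : y ∈ U)
    {A B : Fin 2 → Fin 2 → M → ℝ} {n₀ n₁ : ℝ} (hA : ∀ a b, IsSmoothFun (A a b))
    (hB : ∀ a b, IsSmoothFun (B a b))
    (hAB : ∀ a b, ∀ z ∈ U, D (E b) z (E a z) = A a b z • E 0 z + B a b z • E 1 z)
    (hn : mlieBracket (𝓡 2) (E 0) (E 1) y = n₀ • E 0 y + n₁ • E 1 y) (b : Fin 2) :
    curvature D y (E 0 y) (E 1 y) (E b y) =
      (along (E 0) (A 1 b) y + A 1 b y * A 0 0 y + B 1 b y * A 0 1 y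
        - (along (E 1) (A 0 b) y + A 0 b y * A 1 0 y + B 0 b y * A 1 1 y)
        - (n₀ * A 0 b y + n₁ * A 1 b y)) • E 0 y
      + (along (E 0) (B 1 b) y + A 1 b y * B 0 0 y + B 1 b y * B 0 1 y
        - (along (E 1) (B 0 b) y + A 0 b y * B 1 0 y + B 0 b y * B 1 1 y)
        - (n₀ * B 0 b y + n₁ * B 1 b y)) • E 1 y := by
  rw [curvature_apply hJ hD y (hE.smooth 0) (hE.smooth 1) (hE.smooth b), fieldCurvature,
    hE.cov_of_components D hy (hA 1 b) (hB 1 b) (hAB 1 b),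
    hE.cov_of_components D hy (hA 0 b) (hB 0 b) (hAB 0 b),
    hn, map_add, map_smul, map_smul, hAB 0 b y hy, hAB 1 b y hy]
  simp only [hAB _ _ y hy]
  change (along (E 0) (A 1 b) y • E 0 y + _ + (along (E 0) (B 1 b) y • E 1 y + _))
    - (along (E 1) (A 0 b) y • E 0 y + _ + (along (E 1) (B 0 b) y • E 1 y + _)) - _ = _
  module

/-- Coclosedness is `X_{11} = -X_{00}`. With `along_one_zero`, all first derivatives of the
components of `X` reduce to `derivDiag` and `derivOff`. -/
theorem along_one_one (hE : IsAdaptedFrame J E U) (hJ : IsKahler J) (hD : IsLeviCivita D)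
    (hX : IsHarmonicOneForm D X) {y : M} (hy : y ∈ U) :
    along (E 1) (fun z ↦ X z (E 1 z)) y = -derivDiag D X E y - connForm D E 1 y * X y (E 0 y) := by
  have h := hX.coclosed y
  rw [hE.sum_inverseMetric hJ hy (isBilinearMap_covOneForm hX.smooth D y),
    covOneForm_apply hX.smooth D ((hE.smooth 0).diffAt y),
    covOneForm_apply hX.smooth D ((hE.smooth 1).diffAt y), hE.cov_zero_frame hJ hD hy,
    hE.cov_one_frame hJ hD hy, map_smul, map_smul, smul_eq_mul, smul_eq_mul] at h
  simp only [derivDiag, along]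
  linarith

/-- The Ricci curvature in terms of the curvature endomorphism of an adapted frame. -/
theorem ricci_frame_of_curvature (hE : IsAdaptedFrame J E U) (hJ : IsKahler J)
    {D : AffineConnection M}
    (hD : CovariantDerivative.ContMDiffCovariantDerivative D ∞) {y : M} (hy : y ∈ U) (w : 𝕋 y)
    {p q : ℝ} (h : curvature D y (E 0 y) (E 1 y) w = p • E 0 y + q • E 1 y) :
    ricci D y (E 0 y) w = -q ∧ ricci D y (E 1 y) w = p := by
  have h0 (u : 𝕋 y) : curvature D y u u w = 0 := by
    have h := add_eq_zero_iff_eq_neg.2 (curvature_swap D y u u w)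
    rwa [← two_smul ℝ, smul_eq_zero_iff_right two_ne_zero] at h
  rw [ricci_eq_frame hJ hD hE hy, ricci_eq_frame hJ hD hE hy, h0, h0,
    curvature_swap D y (E 1 y) (E 0 y), h]
  simp only [inner_neg_left, inner_add_left, real_inner_smul_left, hE.inner_zero_zero y hy,
    hE.inner_zero_one hJ hy, hE.inner_one_zero hJ hy, hE.inner_one_one hJ hy, inner_zero_left]
  constructor <;> ring

/-- These are the frame components of `K g - 2 DX(J·,·) + 8 X ⊗ X - 2 |X|² g`. The zero terms pad
all four to the common shape differentiated by `along_quadratic`. -/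
theorem ricci_deformedConnection (hE : IsAdaptedFrame J E U) (hJ : IsKahler J)
    (hD : IsLeviCivita D) (hX : IsHarmonicOneForm D X) {y : M} (hy : y ∈ U) :
    (ricci (deformedConnection (kahlerForm J) D X) y (E 0 y) (E 0 y) =
        gaussCurv D E y + -2 * derivOff D X E y + 6 * (X y (E 0 y) * X y (E 0 y))
          + -2 * (X y (E 1 y) * X y (E 1 y)) + 0 * (X y (E 0 y) * X y (E 1 y)) ∧
      ricci (deformedConnection (kahlerForm J) D X) y (E 1 y) (E 0 y) =
        0 + 2 * derivDiag D X E y + 0 * (X y (E 0 y) * X y (E 0 y))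
          + 0 * (X y (E 1 y) * X y (E 1 y)) + 8 * (X y (E 0 y) * X y (E 1 y))) ∧
      ricci (deformedConnection (kahlerForm J) D X) y (E 0 y) (E 1 y) =
        0 + 2 * derivDiag D X E y + 0 * (X y (E 0 y) * X y (E 0 y))
          + 0 * (X y (E 1 y) * X y (E 1 y)) + 8 * (X y (E 0 y) * X y (E 1 y)) ∧
      ricci (deformedConnection (kahlerForm J) D X) y (E 1 y) (E 1 y) =
        gaussCurv D E y + 2 * derivOff D X E y + -2 * (X y (E 0 y) * X y (E 0 y))
          + 6 * (X y (E 1 y) * X y (E 1 y)) + 0 * (X y (E 0 y) * X y (E 1 y)) := by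
  have hD' := contMDiffCovariantDerivative_deformedConnection hD.smooth hJ hX.smooth
  have hn := hE.mlieBracket_eq hJ hD hy
  rw [sub_eq_add_neg, ← neg_smul] at hn
  have hc (b : Fin 2) := hE.curvature_of_components hJ hD' hy
    (fun a b ↦ (hE.isSmoothFun_coeff hD hX.smooth a b).1)
    (fun a b ↦ (hE.isSmoothFun_coeff hD hX.smooth a b).2)
    (fun a b z hz ↦ hE.deformedConnection_frame hJ hD X hz a b) hn b
  have hθ (a : Fin 2) := (hE.isSmoothFun_connForm hD a).diffAt y
  have hx (a : Fin 2) := (IsSmoothForm.apply hX.smooth (hE.smooth a)).diffAt y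
  have hcx (c : ℝ) (a : Fin 2) : FunDiffAt (fun z ↦ c * X z (E a z)) y :=
    ((isSmoothFun_const c).diffAt y).mul (hx a)
  have hK : gaussCurv D E y = -(along (E 0) (connForm D E 1) y - along (E 1) (connForm D E 0) y
    + connForm D E 0 y * connForm D E 0 y + connForm D E 1 y * connForm D E 1 y) := rfl
  have hb : derivOff D X E y = _ := rfl
  have h00 : along (E 0) (fun z ↦ X z (E 0 z)) y =
      derivDiag D X E y + connForm D E 0 y * X y (E 1 y) := by rw [derivDiag]; ring
  have h01 : along (E 0) (fun z ↦ X z (E 1 z)) y =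
      derivOff D X E y - connForm D E 0 y * X y (E 0 y) := by rw [derivOff]; ring
  have h10 := hE.along_one_zero hJ hD hX hy
  have h11 := hE.along_one_one hJ hD hX hy
  refine ⟨?_, ?_⟩
  · obtain ⟨e0, e1⟩ := hE.ricci_frame_of_curvature hJ hD' hy _ (hc 0)
    rw [e0, e1, hK]
    simp only [coeffZero, coeffOne, Matrix.of_apply, Matrix.cons_val', Matrix.cons_val_zero,
      Matrix.cons_val_one, Matrix.cons_val_fin_one, along_sub (hθ _) (hx _),
      along_sub (hθ _) (hcx _ _), along_const_mul _ (hx _), h00, h01, h10, h11]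
    constructor <;> ring
  · obtain ⟨e0, e1⟩ := hE.ricci_frame_of_curvature hJ hD' hy _ (hc 1)
    rw [e0, e1, hK]
    simp only [coeffZero, coeffOne, Matrix.of_apply, Matrix.cons_val', Matrix.cons_val_zero,
      Matrix.cons_val_one, Matrix.cons_val_fin_one, along_sub (hx _) (hθ _),
      along_sub (hcx _ _) (hθ _), along_const_mul _ (hx _), h00, h01, h10, h11]
    constructor <;> ring

end IsAdaptedFrame

end FrameCurvature

/-! ### The curvature one-form of the deformed connection -/

section CurvatureForm

variable {M : Type*} [TopologicalSpace M] [T2Space M] [ChartedSpace (EuclideanSpace ℝ (Fin 2)) M]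
  [IsManifold (𝓡 2) ∞ M] [RiemannianBundle (fun x : M ↦ TangentSpace (𝓡 2) x)]
  [IsContMDiffRiemannianBundle (𝓡 2) ∞ (EuclideanSpace ℝ (Fin 2))
  (fun x : M ↦ TangentSpace (𝓡 2) x)] {J : Π x : M, 𝕋 x →L[ℝ] 𝕋 x}
  {E : Fin 2 → Π x : M, 𝕋 x} {U : Set M} {D : AffineConnection M} {X : Π x : M, 𝕋 x →L[ℝ] ℝ}

/-- The Ricci curvature of the deformed connection is symmetric. -/
theorem ricci_deformedConnection_comm (hJ : IsKahler J) (hD : IsLeviCivita D)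
    (hX : IsHarmonicOneForm D X) (x : M) (v w : 𝕋 x) :
    ricci (deformedConnection (kahlerForm J) D X) x v w =
      ricci (deformedConnection (kahlerForm J) D X) x w v := by
  obtain ⟨E, U, hx, hE⟩ := exists_isAdaptedFrame hJ x
  have hB := isBilinearMap_ricci hJ
    (contMDiffCovariantDerivative_deformedConnection hD.smooth hJ hX.smooth) x
  have h := hE.ricci_deformedConnection hJ hD hX hx
  rw [hE.bilin_expand hJ hx hB v w, hE.bilin_expand hJ hx hB w v, h.1.2, h.2.1]
  ring

namespace IsAdaptedFrame

/-- The components of the Ricci curvature of the deformed connection are smooth. -/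
theorem diffAt_ricci_deformedConnection (hE : IsAdaptedFrame J E U) (hJ : IsKahler J)
    (hD : IsLeviCivita D) (hX : IsHarmonicOneForm D X) {x : M} (hx : x ∈ U) (a b : Fin 2) :
    FunDiffAt
      (fun y ↦ ricci (deformedConnection (kahlerForm J) D X) y (E a y) (E b y)) x := by
  have hX' : IsSmoothForm X := hX.smooth
  have hK := (hE.isSmoothFun_gaussCurv hD).diffAt x
  have hA := (hE.isSmoothFun_derivDiag hD hX').diffAt x
  have hO := (hE.isSmoothFun_derivOff hD hX').diffAt x
  have hx' (a : Fin 2) := (hX'.apply (hE.smooth a)).diffAt x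
  have hc (c : ℝ) {h : M → ℝ} (hh : FunDiffAt h x) : FunDiffAt (fun y ↦ c * h y) x :=
    ((isSmoothFun_const c).diffAt x).mul hh
  have hq {k l : M → ℝ} (hk : FunDiffAt k x) (hl : FunDiffAt l x) (c p q r : ℝ) :
      FunDiffAt (fun y ↦ k y + c * l y + p * (X y (E 0 y) * X y (E 0 y))
        + q * (X y (E 1 y) * X y (E 1 y)) + r * (X y (E 0 y) * X y (E 1 y))) x :=
    (((hk.add (hc c hl)).add (hc p ((hx' 0).mul (hx' 0)))).add
      (hc q ((hx' 1).mul (hx' 1)))).add (hc r ((hx' 0).mul (hx' 1)))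
  have h (y : M) (hy : y ∈ U) := hE.ricci_deformedConnection hJ hD hX hy
  have hz := (isSmoothFun_const (M := M) 0).diffAt x
  have hev {p : M → Prop} (hp : ∀ y ∈ U, p y) : ∀ᶠ y in 𝓝 x, p y :=
    Filter.eventually_of_mem (hE.isOpen.mem_nhds hx) hp
  fin_cases a <;> fin_cases b
  · exact (hq hK hO _ _ _ _).congr_of_eventuallyEq (hev fun y hy ↦ (h y hy).1.1)
  · exact (hq hz hA _ _ _ _).congr_of_eventuallyEq (hev fun y hy ↦ (h y hy).2.1)
  · exact (hq hz hA _ _ _ _).congr_of_eventuallyEq (hev fun y hy ↦ (h y hy).1.2)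
  · exact (hq hK hO _ _ _ _).congr_of_eventuallyEq (hev fun y hy ↦ (h y hy).2.2)

/-- Second derivatives of `X` enter only through the divergence of `DX`. Commuting derivatives along
the frame evaluates it, and this is where the Gauss curvature multiplies `X`. -/
theorem curvatureOneForm_deformedConnection (hE : IsAdaptedFrame J E U) (hJ : IsKahler J)
    (hD : IsLeviCivita D) (hX : IsHarmonicOneForm D X) {x : M} (hx : x ∈ U) :
    curvatureOneForm (kahlerForm J) (deformedConnection (kahlerForm J) D X) x (E 0 x) =
        2 * along (E 1) (gaussCurv D E) x - 12 * gaussCurv D E x * X x (E 0 x) ∧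
      curvatureOneForm (kahlerForm J) (deformedConnection (kahlerForm J) D X) x (E 1 x) =
        -2 * along (E 0) (gaussCurv D E) x - 12 * gaussCurv D E x * X x (E 1 x) := by
  have hX' : IsSmoothForm X := hX.smooth
  have hD' := contMDiffCovariantDerivative_deformedConnection hD.smooth hJ hX'
  have hR := hE.diffAt_ricci_deformedConnection hJ hD hX hx
  have hB := isBilinearMap_ricci hJ hD'
  have hK := (hE.isSmoothFun_gaussCurv hD).diffAt x
  have hA := (hE.isSmoothFun_derivDiag hD hX').diffAt x
  have hO := (hE.isSmoothFun_derivOff hD hX').diffAt x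
  have hx' (a : Fin 2) := (hX'.apply (hE.smooth a)).diffAt x
  have hθ (a : Fin 2) := (hE.isSmoothFun_connForm hD a).diffAt x
  have hz := (isSmoothFun_const (M := M) 0).diffAt x
  have hev {p : M → Prop} (hp : ∀ y ∈ U, p y) : ∀ᶠ y in 𝓝 x, p y :=
    Filter.eventually_of_mem (hE.isOpen.mem_nhds hx) hp
  have h (y : M) (hy : y ∈ U) := hE.ricci_deformedConnection hJ hD hX hy
  have h00 : along (E 0) (fun z ↦ X z (E 0 z)) x =
      derivDiag D X E x + connForm D E 0 x * X x (E 1 x) := by rw [derivDiag]; ring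
  have h01 : along (E 0) (fun z ↦ X z (E 1 z)) x =
      derivOff D X E x - connForm D E 0 x * X x (E 0 x) := by rw [derivOff]; ring
  have h10 := hE.along_one_zero hJ hD hX hx
  have h11 := hE.along_one_one hJ hD hX hx
  have hKx : gaussCurv D E x = -(along (E 0) (connForm D E 1) x - along (E 1) (connForm D E 0) x
    + connForm D E 0 x * connForm D E 0 x + connForm D E 1 x * connForm D E 1 x) := rfl
  have hmul (a b : Fin 2) : FunDiffAt (fun y ↦ connForm D E a y * X y (E b y)) x :=
    (hθ a).mul (hx' b)
  have hA' : FunDiffAt (fun y ↦ -1 * derivDiag D X E y) x :=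
    ((isSmoothFun_const (-1)).diffAt x).mul hA
  -- After rewriting, `c0` and `c1` are the two components of the Weitzenböck identity `D^p D_p X =
  -- K X`, with `K` still expressed by the connection form.
  have c0 := hE.along_comm hJ hD hx (hX'.apply (hE.smooth 0))
  have c1 := hE.along_comm hJ hD hx (hX'.apply (hE.smooth 1))
  rw [along_congr (Y := E 0) (hev fun y hy ↦ hE.along_one_zero hJ hD hX hy),
    along_congr (Y := E 1) (f := along (E 0) fun y ↦ X y (E 0 y))
      (g := fun y ↦ derivDiag D X E y + connForm D E 0 y * X y (E 1 y))
      (.of_forall fun y ↦ by rw [derivDiag]; ring),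
    along_add hO (hmul 1 1), along_add hA (hmul 0 1), along_mul (hθ 1) (hx' 1),
    along_mul (hθ 0) (hx' 1), h00, h01, h10, h11] at c0
  rw [along_congr (Y := E 0) (g := fun y ↦ -1 * derivDiag D X E y - connForm D E 1 y * X y (E 0 y))
      (hev fun y hy ↦ by rw [hE.along_one_one hJ hD hX hy]; ring),
    along_congr (Y := E 1) (f := along (E 0) fun y ↦ X y (E 1 y))
      (g := fun y ↦ derivOff D X E y - connForm D E 0 y * X y (E 0 y))
      (.of_forall fun y ↦ by rw [derivOff]; ring),
    along_sub hA' (hmul 1 0), along_sub hO (hmul 0 0),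
    along_const_mul (-1) hA, along_mul (hθ 1) (hx' 0),
    along_mul (hθ 0) (hx' 0), h00, h01, h10, h11] at c1
  have key (a b c : Fin 2) : covTwoTensor (deformedConnection (kahlerForm J) D X)
      (ricci (deformedConnection (kahlerForm J) D X)) x (E c x) (E a x) (E b x) =
      along (E c) (fun y ↦ ricci (deformedConnection (kahlerForm J) D X) y (E a y) (E b y)) x
      - (coeffZero D X E c a x *
            ricci (deformedConnection (kahlerForm J) D X) x (E 0 x) (E b x)
          + coeffOne D X E c a x *
            ricci (deformedConnection (kahlerForm J) D X) x (E 1 x) (E b x))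
      - (coeffZero D X E c b x *
            ricci (deformedConnection (kahlerForm J) D X) x (E a x) (E 0 x)
          + coeffOne D X E c b x *
            ricci (deformedConnection (kahlerForm J) D X) x (E a x) (E 1 x)) := by
    rw [covTwoTensor_apply hE hJ hx _ hB hR ((hE.smooth a).diffAt x) ((hE.smooth b).diffAt x),
      hE.deformedConnection_frame hJ hD X hx, hE.deformedConnection_frame hJ hD X hx]
    simp only [(hB x).add_left, (hB x).smul_left, (hB x).add_right, (hB x).smul_right, smul_eq_mul]
    rfl
  simp only [curvatureOneForm_eq_frame hD' hE hJ hx hR, key]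
  rw [along_congr (hev fun y hy ↦ (h y hy).1.1), along_congr (hev fun y hy ↦ (h y hy).2.1),
    along_congr (hev fun y hy ↦ (h y hy).1.2), along_congr (hev fun y hy ↦ (h y hy).2.2),
    along_quadratic hK hO (hx' 0) (hx' 1), along_quadratic hz hA (hx' 0) (hx' 1),
    along_quadratic hz hA (hx' 0) (hx' 1), along_quadratic hK hO (hx' 0) (hx' 1), along_const,
    along_const, (h x hx).1.1, (h x hx).1.2, (h x hx).2.1, (h x hx).2.2, h00, h01, h10, h11]
  simp only [coeffZero, coeffOne, Matrix.of_apply, Matrix.cons_val', Matrix.cons_val_zero,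
    Matrix.cons_val_one, Matrix.cons_val_fin_one]
  constructor
  -- The factor 4 is the 2 in the definition of `ρ` times the coefficient 2 of `DX` in the Ricci
  -- tensor. `hKx` trades the connection form for the Gauss curvature.
  · linear_combination 4 * c1 + 4 * X x (E 0 x) * hKx
  · linear_combination -4 * c0 + 4 * X x (E 1 x) * hKx

end IsAdaptedFrame

end CurvatureForm

/-! ### Symmetric Ricci tensors, quadratic invariants and moment flatness -/

section GeneralConnections

variable {M : Type*} [TopologicalSpace M] [ChartedSpace (EuclideanSpace ℝ (Fin 2)) M]
  [IsManifold (𝓡 2) ∞ M]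

theorem covTwoTensor_comm (D : AffineConnection M) {B : Π x : M, 𝕋 x → 𝕋 x → ℝ}
    (hB : ∀ x v w, B x v w = B x w v) (x : M) (u v w : 𝕋 x) :
    covTwoTensor D B x u v w = covTwoTensor D B x u w v := by
  simp only [covTwoTensor, fun y ↦ hB y (field v y), hB x _ w, hB x v]
  ring

theorem projSchouten_of_ricci_comm {D : AffineConnection M}
    (h : ∀ x v w, ricci D x v w = ricci D x w v) :
    projSchouten D = fun x v w ↦ -1 * ricci D x v w := by
  ext x v w
  rw [projSchouten, h x w v]
  ring

/-- In dimension two the squares of the curvature and of the Ricci curvature are proportional. -/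
theorem curvatureSq_eq_ricciSq [RiemannianBundle (fun x : M ↦ TangentSpace (𝓡 2) x)]
    {J : Π x : M, 𝕋 x →L[ℝ] 𝕋 x} (hJ : IsKahler J) (D : AffineConnection M) (x : M) :
    curvatureSq (kahlerForm J) D x = 2 * ricciSq (kahlerForm J) D x := by
  have ht := kahlerForm_basis_ne_zero hJ x
  set b := basis x with hb
  set t := kahlerForm J x (b 0) (b 1) with htdef
  have h0 (u w : 𝕋 x) : curvature D x u u w = 0 := by
    have h := add_eq_zero_iff_eq_neg.2 (curvature_swap D x u u w)
    rwa [← two_smul ℝ, smul_eq_zero_iff_right two_ne_zero] at h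
  -- Together with `hΩ` this says `R_{ijkl} = Ω_{ij} R_{lk}`, with no symmetry of Ricci assumed. The
  -- factor 2 is then `Ω^{ij} Ω_{ij}`.
  have hr (w : 𝕋 x) : ricci D x (b 0) w = -b.repr (curvature D x (b 0) (b 1) w) 1 ∧
      ricci D x (b 1) w = b.repr (curvature D x (b 0) (b 1) w) 0 := by
    simp only [ricci, Fin.sum_univ_two, ← hb, h0, curvature_swap D x (b 1) (b 0)]
    simp
  have hΩ (v : 𝕋 x) : kahlerForm J x v (b 0) = -t * b.repr v 1 ∧
      kahlerForm J x v (b 1) = t * b.repr v 0 := by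
    have hv := b.sum_repr v
    rw [Fin.sum_univ_two] at hv
    constructor
    · conv_lhs => rw [← hv]
      rw [map_add, map_smul, map_smul, add_apply, smul_apply, smul_apply, hJ.kahlerForm_self,
        hJ.kahlerForm_swap x (b 1) (b 0), smul_eq_mul, smul_eq_mul, ← htdef]
      ring
    · conv_lhs => rw [← hv]
      rw [map_add, map_smul, map_smul, add_apply, smul_apply, smul_apply, hJ.kahlerForm_self,
        smul_eq_mul, smul_eq_mul, ← htdef]
      ring
  simp only [curvatureSq, ricciSq, ricciLow, curvatureLow, dualBivector_kahlerForm hJ, ← hb,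
    ← htdef, Fin.sum_univ_two, (hΩ _).1, (hΩ _).2, (hr _).1, (hr _).2, h0,
    curvature_swap D x (b 1) (b 0), map_neg, map_zero, Matrix.of_apply, Matrix.cons_val',
    Matrix.cons_val_zero, Matrix.cons_val_one, Matrix.cons_val_fin_one, zero_mul, mul_zero,
    add_zero, zero_add, Finsupp.coe_neg, Pi.neg_apply, Finsupp.coe_zero, Pi.zero_apply]
  field_simp
  ring

end GeneralConnections

section MomentMap

variable {M : Type*} [TopologicalSpace M] [T2Space M] [ChartedSpace (EuclideanSpace ℝ (Fin 2)) M]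
  [IsManifold (𝓡 2) ∞ M] [RiemannianBundle (fun x : M ↦ TangentSpace (𝓡 2) x)]
  {J : Π x : M, 𝕋 x →L[ℝ] 𝕋 x} {D : AffineConnection M} {X : Π x : M, 𝕋 x →L[ℝ] ℝ}

/-- The two quadratic terms cancel by `curvatureSq_eq_ricciSq`. The remaining one pairs `∇ρ` with a
skew bivector, and the skew part of `∇(cX)` vanishes because `X` is closed and the difference tensor
is symmetric. -/
theorem isMomentFlat_of_curvatureOneForm (hJ : IsKahler J) (hX : IsHarmonicOneForm D X) {c : ℝ}
    (h : ∀ (x : M) (v : 𝕋 x),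
      curvatureOneForm (kahlerForm J) (deformedConnection (kahlerForm J) D X) x v = c * X x v) :
    IsMomentFlat (kahlerForm J) (deformedConnection (kahlerForm J) D X) := by
  intro x
  have hρ : curvatureOneForm (kahlerForm J) (deformedConnection (kahlerForm J) D X) =
      fun y w ↦ c * X y w := by
    ext y w
    exact h y w
  have hd (v : 𝕋 x) : FunDiffAt (fun y ↦ X y (field v y)) x := by
    obtain ⟨Z, hZ, hZv, -⟩ := exists_isSmoothField_eq_field v
    exact ((IsSmoothForm.apply hX.smooth hZ).diffAt x).congr_of_eventuallyEq
      (hZv.mono fun y hy ↦ by simp only [hy])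
  have hcov (u v : 𝕋 x) : covOneForm (deformedConnection (kahlerForm J) D X)
      (fun y w ↦ c * X y w) x u v = c * (covOneForm D (fun y w ↦ X y w) x u v
        - X x (differenceTensor (kahlerForm J) X x v u)) := by
    rw [covOneForm, covOneForm, deformedConnection_apply, field_self, map_add,
      mvfderiv_fun_mul ((isSmoothFun_const c).diffAt x) (hd v), mvfderiv_const]
    simp only [add_apply, smul_apply, smul_eq_mul, zero_apply]
    ring
  rw [momentMap, curvatureSq_eq_ricciSq hJ, hρ]
  simp only [hcov, dualBivector_kahlerForm hJ, Fin.sum_univ_two, Matrix.of_apply, Matrix.cons_val',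
    Matrix.cons_val_zero, Matrix.cons_val_one, Matrix.cons_val_fin_one]
  rw [hX.closed x (basis x 0) (basis x 1),
    differenceTensor_comm (kahlerForm J) X x (basis x 0) (basis x 1)]
  ring

end MomentMap

/-! ### Global consequences: symplecticity, the formula for `ρ`, projective flatness -/

section Deformed

variable {M : Type*} [TopologicalSpace M] [ChartedSpace (EuclideanSpace ℝ (Fin 2)) M]
  [IsManifold (𝓡 2) ∞ M] [RiemannianBundle (fun x : M ↦ TangentSpace (𝓡 2) x)]

/-- With `isHarmonicOneForm_zero`, this lets the frame formulas for `∇` be read at `X = 0` as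
formulas for `D`, so no separate Levi-Civita computation is needed. -/
theorem deformedConnection_zero (Ω : Π x : M, 𝕋 x →L[ℝ] 𝕋 x →L[ℝ] ℝ) (D : AffineConnection M) :
    deformedConnection Ω D 0 = D := by
  refine CovariantDerivative.ext (funext fun Y ↦ funext fun x ↦ ContinuousLinearMap.ext fun u ↦ ?_)
  rw [deformedConnection_apply, differenceTensor_apply]
  simp [raise, cubicForm]

theorem isHarmonicOneForm_zero (D : AffineConnection M) : IsHarmonicOneForm D 0 where
  smooth := Bundle.contMDiff_zeroSection ℝ (fun x : M ↦ 𝕋 x →L[ℝ] ℝ)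
  closed x u v := by simp [covOneForm, mvfderiv_const]
  coclosed x := by simp [covOneForm, mvfderiv_const]

variable [T2Space M] [IsContMDiffRiemannianBundle (𝓡 2) ∞ (EuclideanSpace ℝ (Fin 2))
  (fun x : M ↦ TangentSpace (𝓡 2) x)] {J : Π x : M, 𝕋 x →L[ℝ] 𝕋 x}
  {D : AffineConnection M} {X : Π x : M, 𝕋 x →L[ℝ] ℝ}

/-- The Kähler form is parallel for the Levi-Civita connection. -/
theorem covTwoTensor_kahlerForm (hJ : IsKahler J) (hD : IsLeviCivita D) (x : M) (u v w : 𝕋 x) :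
    covTwoTensor D (fun y a b ↦ kahlerForm J y a b) x u v w = 0 := by
  obtain ⟨E, U, hx, hE⟩ := exists_isAdaptedFrame hJ x
  have hB := isBilinearMap_kahlerForm J
  have hBE (a b : Fin 2) : FunDiffAt (fun y ↦ kahlerForm J y (E a y) (E b y)) x :=
    ((hJ.smooth_apply (hE.smooth a)).inner (hE.smooth b)).diffAt x
  have hev {p : M → Prop} (hp : ∀ y ∈ U, p y) : ∀ᶠ y in 𝓝 x, p y :=
    Filter.eventually_of_mem (hE.isOpen.mem_nhds hx) hp
  have key (a b : Fin 2) := covTwoTensor_apply hE hJ hx D hB hBE ((hE.smooth a).diffAt x)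
    ((hE.smooth b).diffAt x) u
  -- The frame components of `Ω` are constant, and `D` acts on the frame by infinitesimal rotations,
  -- which preserve the area form.
  rw [hE.bilin_expand hJ hx (isBilinearMap_covTwoTensor hE hJ hx D hB hBE u), key, key, key, key,
    mvfderiv_eq_zero_of_eventually_const (hev fun y _ ↦ hJ.kahlerForm_self y (E 0 y)),
    mvfderiv_eq_zero_of_eventually_const (hev fun y _ ↦ hJ.kahlerForm_self y (E 1 y)),
    mvfderiv_eq_zero_of_eventually_const (hev fun y hy ↦ hE.kahlerForm_zero_one hJ hy),
    mvfderiv_eq_zero_of_eventually_const (c := -1) (hev fun y hy ↦ by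
      rw [hJ.kahlerForm_swap, hE.kahlerForm_zero_one hJ hy]),
    hE.cov_zero hJ hD hx, hE.cov_one hJ hD hx]
  simp only [(hB x).smul_left, (hB x).smul_right, hJ.kahlerForm_self,
    hJ.kahlerForm_swap x (E 1 x) (E 0 x), smul_eq_mul]
  ring

/-- Lowering the index of `Π` with `Ω` gives a totally symmetric tensor, so its two contributions to
`∇Ω` cancel and `∇Ω = DΩ = 0`. -/
theorem isSymplecticConnection_deformedConnection (hJ : IsKahler J) (hD : IsLeviCivita D)
    (hX : IsSmoothForm X) :
    IsSymplecticConnection (kahlerForm J) (deformedConnection (kahlerForm J) D X) where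
  smooth := contMDiffCovariantDerivative_deformedConnection hD.smooth hJ hX
  torsion_eq_zero := torsion_deformedConnection hD.torsion_eq_zero
  parallel x u v w := by
    have h := covTwoTensor_kahlerForm hJ hD x u v w
    simp only [covTwoTensor] at h ⊢
    simp only [deformedConnection_apply, map_add, add_apply, kahlerForm_differenceTensor hJ,
      field_self, hJ.kahlerForm_swap x v (differenceTensor (kahlerForm J) X x w u)]
    have hc : cubicForm X x v u w = cubicForm X x w u v := by
      simp only [cubicForm, real_inner_comm]
      ring
    rw [hc]
    linarith

theorem IsAdaptedFrame.scalarCurvature_eq {E : Fin 2 → Π x : M, 𝕋 x} {U : Set M}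
    (hE : IsAdaptedFrame J E U) (hJ : IsKahler J) (hD : IsLeviCivita D) {x : M} (hx : x ∈ U) :
    scalarCurvature D x = 2 * gaussCurv D E x := by
  have h := hE.ricci_deformedConnection hJ hD (isHarmonicOneForm_zero D) hx
  rw [deformedConnection_zero] at h
  rw [scalarCurvature, hE.sum_inverseMetric hJ hx (isBilinearMap_ricci hJ hD.smooth x), h.1.1,
    h.2.2]
  simp
  ring

/-- The derivatives of `K` in the frame formula do not involve `X`, so comparing with the case `X =
0` identifies them as `ρ(D)`. -/
theorem curvatureOneForm_deformedConnection (hJ : IsKahler J) (hD : IsLeviCivita D)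
    (hX : IsHarmonicOneForm D X) (x : M) (v : 𝕋 x) :
    curvatureOneForm (kahlerForm J) (deformedConnection (kahlerForm J) D X) x v =
      curvatureOneForm (kahlerForm J) D x v - 6 * scalarCurvature D x * X x v := by
  obtain ⟨E, U, hx, hE⟩ := exists_isAdaptedFrame hJ x
  have h := hE.curvatureOneForm_deformedConnection hJ hD hX hx
  have h0 := hE.curvatureOneForm_deformedConnection hJ hD (isHarmonicOneForm_zero D) hx
  have hR0 := hE.diffAt_ricci_deformedConnection hJ hD (isHarmonicOneForm_zero D) hx
  rw [deformedConnection_zero] at h0 hR0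
  rw [curvatureOneForm_expand
      (contMDiffCovariantDerivative_deformedConnection hD.smooth hJ hX.smooth) hE hJ hx
      (hE.diffAt_ricci_deformedConnection hJ hD hX hx) v,
    curvatureOneForm_expand hD.smooth hE hJ hx hR0 v, h.1, h.2, h0.1, h0.2,
    hE.scalarCurvature_eq hJ hD hx]
  have hv : X x v = inner ℝ v (E 0 x) * X x (E 0 x) + inner ℝ v (E 1 x) * X x (E 1 x) := by
    conv_lhs => rw [hE.expand hJ hx v]
    rw [map_add, map_smul, map_smul, smul_eq_mul, smul_eq_mul]
  rw [hv]
  simp only [Pi.zero_apply, zero_apply]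
  ring

/-- The curvature one-form of a surface of constant curvature vanishes. -/
theorem curvatureOneForm_eq_zero (hJ : IsKahler J) (hD : IsLeviCivita D) {c : ℝ}
    (hc : ∀ x, scalarCurvature D x = c) (x : M) (v : 𝕋 x) :
    curvatureOneForm (kahlerForm J) D x v = 0 := by
  obtain ⟨E, U, hx, hE⟩ := exists_isAdaptedFrame hJ x
  have h0 := hE.curvatureOneForm_deformedConnection hJ hD (isHarmonicOneForm_zero D) hx
  have hR0 := hE.diffAt_ricci_deformedConnection hJ hD (isHarmonicOneForm_zero D) hx
  rw [deformedConnection_zero] at h0 hR0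
  have hK (a : Fin 2) : along (E a) (gaussCurv D E) x = 0 := by
    refine mvfderiv_eq_zero_of_eventually_const (c := c / 2)
      (Filter.eventually_of_mem (hE.isOpen.mem_nhds hx) fun y hy ↦ ?_) _
    rw [← hc y, hE.scalarCurvature_eq hJ hD hy]
    ring
  rw [curvatureOneForm_expand hD.smooth hE hJ hx hR0 v, h0.1, h0.2, hK, hK]
  simp

/-- Since Ricci is symmetric, the Schouten tensor is `-Ric`, and in a frame `ρ(v) = -2 C(E 1, E 0,
v)` with `C` the Cotton tensor. -/
theorem curvatureOneForm_eq_zero_of_isProjectivelyFlat (hJ : IsKahler J) (hD : IsLeviCivita D)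
    (hX : IsHarmonicOneForm D X)
    (h : IsProjectivelyFlat (deformedConnection (kahlerForm J) D X)) (x : M) (v : 𝕋 x) :
    curvatureOneForm (kahlerForm J) (deformedConnection (kahlerForm J) D X) x v = 0 := by
  obtain ⟨E, U, hx, hE⟩ := exists_isAdaptedFrame hJ x
  have hD' := contMDiffCovariantDerivative_deformedConnection hD.smooth hJ hX.smooth
  have hs := ricci_deformedConnection_comm hJ hD hX
  have hR := hE.diffAt_ricci_deformedConnection hJ hD hX hx
  have hB := isBilinearMap_ricci hJ hD'
  rw [curvatureOneForm_eq_frame hD' hE hJ hx hR]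
  set D' := deformedConnection (kahlerForm J) D X
  have hd (u v : 𝕋 x) : FunDiffAt (fun y ↦ ricci D' y (field u y) (field v y)) x :=
    hE.bilin_diffAt hJ hx hB hR (fieldDiffAt_field u) (fieldDiffAt_field v)
  have hneg (u v w : 𝕋 x) :
      covTwoTensor D' (projSchouten D') x u v w = -covTwoTensor D' (ricci D') x u v w := by
    rw [projSchouten_of_ricci_comm hs, covTwoTensor, covTwoTensor,
      mvfderiv_fun_mul ((isSmoothFun_const (-1)).diffAt x) (hd v w), mvfderiv_const]
    simp only [add_apply, smul_apply, smul_eq_mul, zero_apply]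
    ring
  have hC := h.2 x (E 1 x) (E 0 x) v
  rw [projCotton, hneg, hneg] at hC
  rw [covTwoTensor_comm D' hs x (E 1 x) v, covTwoTensor_comm D' hs x (E 0 x) v]
  linarith

end Deformed

end Surface

end

theorem mainTheorem10 {M : Type*} [TopologicalSpace M] [T2Space M]
    [ChartedSpace (EuclideanSpace ℝ (Fin 2)) M] [IsManifold (𝓡 2) ∞ M]
    [RiemannianBundle (fun x : M ↦ TangentSpace (𝓡 2) x)]
    [IsContMDiffRiemannianBundle (𝓡 2) ∞ (EuclideanSpace ℝ (Fin 2))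
      (fun x : M ↦ TangentSpace (𝓡 2) x)]
    (J : Π x : M, TangentSpace (𝓡 2) x →L[ℝ] TangentSpace (𝓡 2) x)
    (hJ : Surface.IsKahler J)
    (D : AffineConnection M) (hD : Surface.IsLeviCivita D)
    (X : Π x : M, TangentSpace (𝓡 2) x →L[ℝ] ℝ) (hX : Surface.IsHarmonicOneForm D X) :
    Surface.IsSymplecticConnection (Surface.kahlerForm J)
        (Surface.deformedConnection (Surface.kahlerForm J) D X) ∧
      (∀ (x : M) (v : TangentSpace (𝓡 2) x),
        Surface.curvatureOneForm (Surface.kahlerForm J)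
            (Surface.deformedConnection (Surface.kahlerForm J) D X) x v =
          Surface.curvatureOneForm (Surface.kahlerForm J) D x v
            - 6 * Surface.scalarCurvature D x * X x v) ∧
      ((∃ c : ℝ, ∀ x : M, Surface.scalarCurvature D x = c) →
        (∀ (x : M) (v : TangentSpace (𝓡 2) x),
          Surface.curvatureOneForm (Surface.kahlerForm J)
              (Surface.deformedConnection (Surface.kahlerForm J) D X) x v =
            -6 * Surface.scalarCurvature D x * X x v) ∧
        Surface.IsMomentFlat (Surface.kahlerForm J)
          (Surface.deformedConnection (Surface.kahlerForm J) D X) ∧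
        (Surface.IsProjectivelyFlat (Surface.deformedConnection (Surface.kahlerForm J) D X) →
          (∀ x : M, X x = 0) ∨ ∀ x : M, Surface.scalarCurvature D x = 0)) := by
  have hX' : Surface.IsSmoothForm X := hX.smooth
  have hρ := Surface.curvatureOneForm_deformedConnection hJ hD hX
  refine ⟨Surface.isSymplecticConnection_deformedConnection hJ hD hX', hρ, ?_⟩
  rintro ⟨c, hc⟩
  have h (x : M) (v : TangentSpace (𝓡 2) x) :
      Surface.curvatureOneForm (Surface.kahlerForm J)
        (Surface.deformedConnection (Surface.kahlerForm J) D X) x v = -6 * c * X x v := by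
    rw [hρ, Surface.curvatureOneForm_eq_zero hJ hD hc, hc]
    ring
  refine ⟨fun x v ↦ by rw [h, hc], Surface.isMomentFlat_of_curvatureOneForm hJ hX h, fun hf ↦ ?_⟩
  simp only [hc]
  -- A single constant `c` serves the whole surface, so the alternative is global without
  -- connectedness: if `c ≠ 0`, then `-6 c X = 0` gives `X = 0` at every point.
  refine or_iff_not_imp_right.2 fun hne x ↦ ContinuousLinearMap.ext fun v ↦ ?_
  have hc0 : c ≠ 0 := fun h0 ↦ hne fun _ ↦ h0
  have h0 := Surface.curvatureOneForm_eq_zero_of_isProjectivelyFlat hJ hD hX hf x v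
  rw [h] at h0
  simpa [hc0] using h0
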